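/- Let $k$ be a field and $X$ a well-ordered set. Let $RS\langle X\rangle$ be the free right-symmetric $k$-algebra on $X$ (non-unital, with identity $(x,y,z)=(x,z,y)$, where $(x,y,z)=(xy)z-x(yz)$). Order the non-associative words in $X$ by deg-lex: letters are compared as in $X$; a longer word is greater; words $(u_1)(u_2)$, $(v_1)(v_2)$ of equal length are compared first by $u_1,v_1$ and then by $u_2,v_2$. Good words are defined inductively: every letter is good, and $(v)(w)$ is good iff $v,w$ are good and, in case $v=(v_1)(v_2)$, also $v_2\le w$. The set $W$ of good words is a linear basis of $RS\langle X\rangle$ (Segal); for $f\ne 0$ let $\bar f$ be the greatest good word occurring in the expansion of $f$ in this basis, and call $f$ monic if its coefficient is $1$. Let $S\subseteq RS\langle X\rangle$ be a set of monic elements. An $S$-word is obtained from some $s\in S$ by finitely many (possibly zero) successive multiplications, from the left or from the right, by good words; it is written $[a\,s\,b]$ and called normal if the non-associative word $[a\,\bar s\,b]$ obtained by replacing $s$ by $\bar s$ is good. Let $Id(S)$ be the two-sided ideal generated by $S$, $RS\langle X\mid S\rangle=RS\langle X\rangle/Id(S)$, and let $Irr(S)$ be the set of all good words that are not of the form $[a\,\bar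 s\,b]$ for a normal $S$-word $[a\,s\,b]$, $s\in S$. For $f,g\in S$ with $\bar f=[a\,\bar g\,b]$, the composition of inclusion is $f-[a\,g\,b]$; it is trivial modulo $S$ if it is a linear combination of normal $S$-words $[a_i s_i b_i]$ with $[a_i\bar s_i b_i]<\bar f$. For $f\in S$ and a good word $[w]$ such that $(\bar f)([w])$ is not good, the composition of right multiplication is $f\cdot[w]$; it is trivial modulo $S$ if it is a linear combination of normal $S$-words $[a_i s_i b_i]$ with $[a_i\bar s_i b_i]\le\overline{f\cdot[w]}$. The set $S$ is a Gröbner–Shirshov basis if all these compositions are trivial modulo $S$. Theorem (Composition-Diamond lemma for right-symmetric algebras). The following statements are equivalent: (i) $S$ is a Gröbner–Shirshov basis in $RS\langle X\rangle$. (ii) For every nonzero $f\in Id(S)$ there is a normal $S$-word $[a\,s\,b]$ with $s\in S$ and $\bar f=[a\,\bar s\,b]$. (ii)$'$ Every $f\in Id(S)$ is a finite (possibly empty) linear combination $f=\alpha_1[a_1s_1b_1]+\alpha_2[a_2s_2b_2]+\cdots$ of normal $S$-words with $\alpha_i\in k$, $s_i\in S$ and $[a_1\bar s_1b_1]>[a_2\bar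 s_2b_2]>\cdots$. (iii) $Irr(S)$ is a linear basis of $RS\langle X\mid S\rangle$, i.e. the images of the elements of $Irr(S)$ form a linearly independent family that spans $RS\langle X\mid S\rangle$. -/

import Mathlib

/-! Right-symmetric algebras, good words, normal S-words, Gröbner–Shirshov bases. -/

namespace RSAlg

noncomputable section

universe u v

section Ideals

/-- The two-sided ideal of the (non-unital, non-associative) `k`-algebra `A` generated by a
set `s`: the smallest `k`-subspace that contains `s` and is stable under left and right
multiplication by arbitrary elements of `A`. -/
def algIdeal (k : Type u) {A : Type v} [Field k] [NonUnitalNonAssocRing A] [Module k A]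
    (s : Set A) : Submodule k A :=
  sInf {I : Submodule k A | s ⊆ I ∧ ∀ x ∈ I, ∀ a : A, a * x ∈ I ∧ x * a ∈ I}

theorem algIdeal_mul_left (k : Type u) {A : Type v} [Field k] [NonUnitalNonAssocRing A]
    [Module k A] (s : Set A) {x : A} (hx : x ∈ algIdeal k s) (a : A) :
    a * x ∈ algIdeal k s := by
  simp only [algIdeal, Submodule.mem_sInf] at hx ⊢
  exact fun I hI => (hI.2 x (hx I hI) a).1

theorem algIdeal_mul_right (k : Type u) {A : Type v} [Field k] [NonUnitalNonAssocRing A]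
    [Module k A] (s : Set A) {x : A} (hx : x ∈ algIdeal k s) (a : A) :
    x * a ∈ algIdeal k s := by
  simp only [algIdeal, Submodule.mem_sInf] at hx ⊢
  exact fun I hI => (hI.2 x (hx I hI) a).2

/-- The quotient algebra `A / Id(s)`. -/
def AlgQuot (k : Type u) {A : Type v} [Field k] [NonUnitalNonAssocRing A] [Module k A]
    (s : Set A) : Type v :=
  A ⧸ algIdeal k s

instance AlgQuot.instAddCommGroup (k : Type u) {A : Type v} [Field k]
    [NonUnitalNonAssocRing A] [Module k A] (s : Set A) : AddCommGroup (AlgQuot k s) :=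
  inferInstanceAs (AddCommGroup (A ⧸ algIdeal k s))

instance AlgQuot.instModule (k : Type u) {A : Type v} [Field k]
    [NonUnitalNonAssocRing A] [Module k A] (s : Set A) : Module k (AlgQuot k s) :=
  inferInstanceAs (Module k (A ⧸ algIdeal k s))

/-- The canonical projection `A → A / Id(s)`. -/
def AlgQuot.mk (k : Type u) {A : Type v} [Field k] [NonUnitalNonAssocRing A] [Module k A]
    (s : Set A) : A →ₗ[k] AlgQuot k s :=
  (algIdeal k s).mkQ

theorem AlgQuot.mk_surjective (k : Type u) {A : Type v} [Field k] [NonUnitalNonAssocRing A]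
    [Module k A] (s : Set A) : Function.Surjective (AlgQuot.mk k s) :=
  Submodule.mkQ_surjective _

theorem AlgQuot.mk_eq_mk (k : Type u) {A : Type v} [Field k] [NonUnitalNonAssocRing A]
    [Module k A] (s : Set A) {a b : A} :
    AlgQuot.mk k s a = AlgQuot.mk k s b ↔ a - b ∈ algIdeal k s :=
  Submodule.Quotient.eq _

/-- The product of the quotient algebra, induced by the product of `A`. -/
instance AlgQuot.instMul (k : Type u) {A : Type v} [Field k] [NonUnitalNonAssocRing A]
    [Module k A] (s : Set A) : Mul (AlgQuot k s) where
  mul := Quotient.map₂ (fun a b : A => a * b) (by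
    intro a a' h b b' h'
    have h1 : a - a' ∈ algIdeal k s := (Submodule.quotientRel_def _).1 h
    have h2 : b - b' ∈ algIdeal k s := (Submodule.quotientRel_def _).1 h'
    refine (Submodule.quotientRel_def _).2 ?_
    have h3 : a * b - a' * b' = (a - a') * b + a' * (b - b') := by
      rw [sub_mul, mul_sub]; abel
    rw [h3]
    exact add_mem (algIdeal_mul_right k s h1 b) (algIdeal_mul_left k s h2 a'))

theorem AlgQuot.mk_mul (k : Type u) {A : Type v} [Field k] [NonUnitalNonAssocRing A]
    [Module k A] (s : Set A) (a b : A) :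
    AlgQuot.mk k s (a * b) = AlgQuot.mk k s a * AlgQuot.mk k s b :=
  rfl

instance AlgQuot.instNonUnitalNonAssocRing (k : Type u) {A : Type v} [Field k]
    [NonUnitalNonAssocRing A] [Module k A] (s : Set A) :
    NonUnitalNonAssocRing (AlgQuot k s) :=
  { AlgQuot.instAddCommGroup k s, AlgQuot.instMul k s with
    left_distrib := by
      intro x y z
      obtain ⟨a, rfl⟩ := AlgQuot.mk_surjective k s x
      obtain ⟨b, rfl⟩ := AlgQuot.mk_surjective k s y
      obtain ⟨c, rfl⟩ := AlgQuot.mk_surjective k s z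
      rw [← map_add, ← AlgQuot.mk_mul, mul_add, map_add]; rfl
    right_distrib := by
      intro x y z
      obtain ⟨a, rfl⟩ := AlgQuot.mk_surjective k s x
      obtain ⟨b, rfl⟩ := AlgQuot.mk_surjective k s y
      obtain ⟨c, rfl⟩ := AlgQuot.mk_surjective k s z
      rw [← map_add, ← AlgQuot.mk_mul, add_mul, map_add]; rfl
    zero_mul := by
      intro x
      obtain ⟨a, rfl⟩ := AlgQuot.mk_surjective k s x
      rw [← map_zero (AlgQuot.mk k s), ← AlgQuot.mk_mul, zero_mul]
    mul_zero := by
      intro x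
      obtain ⟨a, rfl⟩ := AlgQuot.mk_surjective k s x
      rw [← map_zero (AlgQuot.mk k s), ← AlgQuot.mk_mul, mul_zero] }

instance AlgQuot.instIsScalarTower (k : Type u) {A : Type v} [Field k]
    [NonUnitalNonAssocRing A] [Module k A] [IsScalarTower k A A] (s : Set A) :
    IsScalarTower k (AlgQuot k s) (AlgQuot k s) where
  smul_assoc r x y := by
    obtain ⟨a, rfl⟩ := AlgQuot.mk_surjective k s x
    obtain ⟨b, rfl⟩ := AlgQuot.mk_surjective k s y
    simp only [smul_eq_mul]
    rw [← map_smul, ← AlgQuot.mk_mul, ← AlgQuot.mk_mul, ← map_smul, smul_mul_assoc]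

instance AlgQuot.instSMulCommClass (k : Type u) {A : Type v} [Field k]
    [NonUnitalNonAssocRing A] [Module k A] [SMulCommClass k A A] (s : Set A) :
    SMulCommClass k (AlgQuot k s) (AlgQuot k s) where
  smul_comm r x y := by
    obtain ⟨a, rfl⟩ := AlgQuot.mk_surjective k s x
    obtain ⟨b, rfl⟩ := AlgQuot.mk_surjective k s y
    simp only [smul_eq_mul]
    rw [← map_smul, ← AlgQuot.mk_mul, ← AlgQuot.mk_mul, ← map_smul, mul_smul_comm]

end Ideals

section FreeRightSymmetric

/-- The elements `(x, y, z) - (x, z, y)` of the free non-associative algebra, where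
`(x, y, z) = (xy)z - x(yz)` is the associator. -/
def rightSymmetricRelators (k : Type u) (X : Type v) [Field k] :
    Set (FreeNonUnitalNonAssocAlgebra k X) :=
  {r | ∃ x y z : FreeNonUnitalNonAssocAlgebra k X, r = associator x y z - associator x z y}

/-- The free right-symmetric algebra `RS⟨X⟩` over `k`: the quotient of the free
non-associative algebra by the ideal generated by the right-symmetric identity. -/
abbrev RS (k : Type u) (X : Type v) [Field k] : Type (max u v) :=
  AlgQuot k (rightSymmetricRelators k X)

/-- The element of `RS⟨X⟩` given by a non-associative word. -/
def word (k : Type u) {X : Type v} [Field k] (w : FreeMagma X) : RS k X :=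
  AlgQuot.mk k (rightSymmetricRelators k X) (MonoidAlgebra.single w 1)

end FreeRightSymmetric

section Words

/-- The degree-lexicographical order on the set of non-associative words. -/
inductive DegLexLT {X : Type v} [LT X] : FreeMagma X → FreeMagma X → Prop
  | letter {x y : X} : x < y → DegLexLT (FreeMagma.of x) (FreeMagma.of y)
  | length {u v : FreeMagma X} : u.length < v.length → DegLexLT u v
  | left {u₁ u₂ v₁ v₂ : FreeMagma X} : (u₁ * u₂).length = (v₁ * v₂).length →
      DegLexLT u₁ v₁ → DegLexLT (u₁ * u₂) (v₁ * v₂)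
  | right {u₁ u₂ v₂ : FreeMagma X} : (u₁ * u₂).length = (u₁ * v₂).length →
      DegLexLT u₂ v₂ → DegLexLT (u₁ * u₂) (u₁ * v₂)

/-- The reflexive closure of the degree-lexicographical order. -/
def DegLexLE {X : Type v} [LT X] (u v : FreeMagma X) : Prop :=
  DegLexLT u v ∨ u = v

/-- Good words: letters are good, and `(v)(w)` is good if `v` and `w` are good and, when
`v = (v₁)(v₂)`, moreover `v₂ ≤ w`. -/
inductive Good {X : Type v} [LT X] : FreeMagma X → Prop
  | letter (x : X) : Good (FreeMagma.of x)
  | mul {v w : FreeMagma X} : Good v → Good w →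
      (∀ v₁ v₂ : FreeMagma X, v = v₁ * v₂ → DegLexLE v₂ w) → Good (v * w)

/-- The set `W` of good words. -/
abbrev GoodWord (X : Type v) [LT X] : Type v :=
  {w : FreeMagma X // Good w}

/-- `f` is a linear combination of good words in which the good word `w` occurs with the
coefficient `a ≠ 0` and every other word that occurs is smaller than `w`. -/
def HasLeadingTerm {k : Type u} {X : Type v} [Field k] [LT X] (f : RS k X)
    (w : GoodWord X) (a : k) : Prop :=
  ∃ c : GoodWord X →₀ k, f = c.sum (fun v b => b • word k v.1) ∧ c w = a ∧ a ≠ 0 ∧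
    ∀ v ∈ c.support, DegLexLE v.1 w.1

/-- `w` is the leading word of `f`. -/
def IsLeadingWord {k : Type u} {X : Type v} [Field k] [LT X] (f : RS k X)
    (w : GoodWord X) : Prop :=
  ∃ a : k, HasLeadingTerm f w a

/-- `f` is monic: its leading word has coefficient `1`. -/
def IsMonic {k : Type u} {X : Type v} [Field k] [LT X] (f : RS k X) : Prop :=
  ∃ w : GoodWord X, HasLeadingTerm f w 1

end Words

section SWords

/-- The shape of an `S`-word: a word with one distinguished place, built from the bare place
by multiplications from the right or from the left by good words. -/
inductive Ctx (X : Type v) [LT X] : Type v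
  | hole : Ctx X
  | mulRight : Ctx X → GoodWord X → Ctx X
  | mulLeft : GoodWord X → Ctx X → Ctx X

/-- The non-associative word obtained by putting the word `t` at the distinguished place. -/
def Ctx.plug {X : Type v} [LT X] : Ctx X → FreeMagma X → FreeMagma X
  | .hole, t => t
  | .mulRight c v, t => c.plug t * v.1
  | .mulLeft v c, t => v.1 * c.plug t

/-- The element of `RS⟨X⟩` obtained by putting the polynomial `s` at the distinguished
place. -/
def Ctx.eval {k : Type u} {X : Type v} [Field k] [LT X] : Ctx X → RS k X → RS k X
  | .hole, s => s
  | .mulRight c v, s => c.eval s * word k v.1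
  | .mulLeft v c, s => word k v.1 * c.eval s

/-- `p` is (the value in `RS⟨X⟩` of) a normal `S`-word `[a s b]`, and `w` is the good word
`[a s̄ b]`. -/
def IsNormalSWord {k : Type u} {X : Type v} [Field k] [LT X] (S : Set (RS k X))
    (p : RS k X) (w : GoodWord X) : Prop :=
  ∃ s ∈ S, ∃ t : GoodWord X, IsLeadingWord s t ∧
    ∃ c : Ctx X, c.plug t.1 = w.1 ∧ c.eval s = p

/-- Every composition of inclusion `f - [a g b]`, where `f, g ∈ S` and `f̄ = [a ḡ b]`, is a
linear combination of normal `S`-words with leading words smaller than `f̄`. -/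
def InclusionTrivial {k : Type u} {X : Type v} [Field k] [LT X] (S : Set (RS k X)) : Prop :=
  ∀ f ∈ S, ∀ g ∈ S, ∀ u t : GoodWord X, IsLeadingWord f u → IsLeadingWord g t →
    ∀ c : Ctx X, u.1 = c.plug t.1 →
      f - c.eval g ∈ Submodule.span k
        {p : RS k X | ∃ v : GoodWord X, IsNormalSWord S p v ∧ DegLexLT v.1 u.1}

/-- Every composition of right multiplication `f · [w]`, where `f ∈ S`, `w` is a good word and
`(f̄ [w])` is not good, is a linear combination of normal `S`-words with leading words
smaller than or equal to the leading word of `f · [w]`. -/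
def RightMulTrivial {k : Type u} {X : Type v} [Field k] [LT X] (S : Set (RS k X)) : Prop :=
  ∀ f ∈ S, ∀ u w : GoodWord X, IsLeadingWord f u → ¬ Good (u.1 * w.1) →
    ∃ l : GoodWord X, IsLeadingWord (f * word k w.1) l ∧
      f * word k w.1 ∈ Submodule.span k
        {p : RS k X | ∃ v : GoodWord X, IsNormalSWord S p v ∧ DegLexLE v.1 l.1}

/-- `S` is a Gröbner–Shirshov basis: all compositions are trivial modulo `S`. -/
def IsGroebnerShirshov {k : Type u} {X : Type v} [Field k] [LT X] (S : Set (RS k X)) :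
    Prop :=
  InclusionTrivial S ∧ RightMulTrivial S

/-- The set `Irr(S)` of good words that are not of the form `[a s̄ b]` for a normal `S`-word
`[a s b]`. -/
def Irr {k : Type u} {X : Type v} [Field k] [LT X] (S : Set (RS k X)) :
    Set (GoodWord X) :=
  {w | ¬ ∃ p : RS k X, IsNormalSWord S p w}

end SWords

end

end RSAlg

/-!
Good words are the normal forms of the rewriting rule
`(a b) c → (a c) b + a (b c) - a (c b)` for `c < b`, which is the right-symmetric identity oriented
so that it lowers words in the degree-lexicographical order; hence good words span `RS⟨X⟩`. For
their linear independence, the rule is used to define a product on the space `NF k X` with basis the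
good words. This product satisfies the right-symmetric identity (`NF.isRightSymm`): the only
ambiguity, a word `((a₁ a₂) b) c` with `c < b < a₂`, is resolved by the Jacobi identity for
commutators (`NF.isRightSymm_step`), as in the Poincaré–Birkhoff–Witt theorem. So `RS⟨X⟩` maps to
`NF k X`, and leading words can be read off in a basis (`goodBasis`). As the rule lowers words, the
product of two good words is a combination of good words that do not exceed the word which is their
product, and a normal `S`-word `[a s b]` has the leading word `[a s̄ b]` with coefficient `1`.

For a Gröbner–Shirshov basis `S`, two facts give the leading words of `Id(S)`. First, a normal
`S`-word times a good word, on either side, is a combination of normal `S`-words bounded by the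
product of the leading words (`mul_mem_normalLE_aux`): if this product is not a good word, rewrite
it by the rule, which lowers it, except when `s` itself is multiplied from the right, where the
triviality of the composition of right multiplication applies. In particular the normal `S`-words
span `Id(S)`. Second, two normal `S`-words with the same leading word differ by smaller normal
`S`-words (`eval_sub_eval_mem`). So, if the bound on the normal `S`-words in an expression of
`f ≠ 0` is the least possible, its terms at this bound cannot cancel, and the bound is the leading
word of `f` (`IsGroebnerShirshov.leadingWordsReducible`).

In the other direction, if leading words of `Id(S)` are leading words of normal `S`-words,
subtracting normal `S`-words from `f ∈ Id(S)` produces an expansion bounded by the leading word of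
`f`, which makes all compositions trivial. The composition `f · [w]` must moreover have a leading
word, so it must not vanish: right multiplication by a good word is injective on `RS⟨X⟩`
(`mul_word_ne_zero`), because to top order in the number of factors at the root it inserts `w` into
the sorted list of these factors. Finally, the images of `Irr(S)` always span the quotient, and
they are independent if and only if no nonzero element of `Id(S)` is a combination of words of
`Irr(S)`, which is the condition on leading words.
-/

namespace RSAlg

/-! ### The degree-lexicographical order -/

section Order

variable {X : Type*}

theorem eq_mul_cases (w : FreeMagma X) :
    (∃ x, w = FreeMagma.of x) ∨ ∃ w₁ w₂, w = w₁ * w₂ := by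
  cases w with
  | of x => exact .inl ⟨x, rfl⟩
  | mul a b => exact .inr ⟨a, b, rfl⟩

theorem mul_inj_iff {a b c d : FreeMagma X} : a * b = c * d ↔ a = c ∧ b = d := by
  constructor
  · intro h
    cases h
    exact ⟨rfl, rfl⟩
  · rintro ⟨rfl, rfl⟩
    rfl

theorem of_ne_mul (x : X) (a b : FreeMagma X) : FreeMagma.of x ≠ a * b :=
  fun h => FreeMagma.noConfusion rfl (heq_of_eq h)

theorem length_mul (a b : FreeMagma X) : (a * b).length = a.length + b.length := rfl

theorem length_of (x : X) : (FreeMagma.of x).length = 1 := rfl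

theorem degLexLT_of_of [LT X] {x y : X} :
    DegLexLT (FreeMagma.of x) (FreeMagma.of y) ↔ x < y := by
  constructor
  · intro h
    generalize hu : FreeMagma.of x = u at h
    generalize hv : FreeMagma.of y = v at h
    cases h with
    | letter h =>
      cases hu
      cases hv
      exact h
    | length h =>
      subst hu hv
      simp at h
    | left => exact absurd hu (of_ne_mul _ _ _)
    | right => exact absurd hu (of_ne_mul _ _ _)
  · exact .letter

theorem degLexLT_of_mul [LT X] (x : X) (a b : FreeMagma X) :
    DegLexLT (FreeMagma.of x) (a * b) := by
  refine .length ?_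
  have := a.length_pos
  have := b.length_pos
  rw [length_mul, length_of]
  omega

theorem degLexLT_mul_mul [LT X] {u₁ u₂ v₁ v₂ : FreeMagma X} :
    DegLexLT (u₁ * u₂) (v₁ * v₂) ↔
      u₁.length + u₂.length < v₁.length + v₂.length ∨
      u₁.length + u₂.length = v₁.length + v₂.length ∧
        (DegLexLT u₁ v₁ ∨ u₁ = v₁ ∧ DegLexLT u₂ v₂) := by
  constructor
  · intro h
    generalize hu : u₁ * u₂ = u at h
    generalize hv : v₁ * v₂ = v at h
    cases h with
    | letter => exact absurd hu.symm (of_ne_mul _ _ _)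
    | length h =>
      subst hu hv
      exact .inl h
    | left hl h =>
      obtain ⟨rfl, rfl⟩ := mul_inj_iff.1 hu
      obtain ⟨rfl, rfl⟩ := mul_inj_iff.1 hv
      exact .inr ⟨hl, .inl h⟩
    | right hl h =>
      obtain ⟨rfl, rfl⟩ := mul_inj_iff.1 hu
      obtain ⟨rfl, rfl⟩ := mul_inj_iff.1 hv
      exact .inr ⟨hl, .inr ⟨rfl, h⟩⟩
  · rintro (h | ⟨hl, h | ⟨rfl, h⟩⟩)
    · exact .length h
    · exact .left hl h
    · exact .right hl h

theorem DegLexLT.length_le [LT X] {u v : FreeMagma X} (h : DegLexLT u v) :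
    u.length ≤ v.length := by
  cases h with
  | letter => exact le_rfl
  | length h => exact h.le
  | left h => exact h.le
  | right h => exact h.le

theorem not_degLexLT_mul_of [LT X] (x : X) (a b : FreeMagma X) :
    ¬ DegLexLT (a * b) (FreeMagma.of x) := by
  intro h
  have h' := h.length_le
  have := a.length_pos
  have := b.length_pos
  rw [length_mul, length_of] at h'
  omega

theorem degLexLT_irrefl [Preorder X] (u : FreeMagma X) : ¬ DegLexLT u u := by
  induction u with
  | ih1 x => simp [degLexLT_of_of]
  | ih2 a b ha hb => simp [degLexLT_mul_mul, ha, hb]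

theorem DegLexLT.trans [Preorder X] {u v w : FreeMagma X} (huv : DegLexLT u v)
    (hvw : DegLexLT v w) : DegLexLT u w := by
  induction u generalizing v w with
  | ih1 x =>
    obtain ⟨z, rfl⟩ | ⟨w₁, w₂, rfl⟩ := eq_mul_cases w
    · obtain ⟨y, rfl⟩ | ⟨v₁, v₂, rfl⟩ := eq_mul_cases v
      · rw [degLexLT_of_of] at *
        exact huv.trans hvw
      · exact absurd hvw (not_degLexLT_mul_of _ _ _)
    · exact degLexLT_of_mul _ _ _
  | ih2 a b ha hb =>
    obtain ⟨y, rfl⟩ | ⟨v₁, v₂, rfl⟩ := eq_mul_cases v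
    · exact absurd huv (not_degLexLT_mul_of _ _ _)
    obtain ⟨z, rfl⟩ | ⟨w₁, w₂, rfl⟩ := eq_mul_cases w
    · exact absurd hvw (not_degLexLT_mul_of _ _ _)
    rw [degLexLT_mul_mul] at *
    obtain h | ⟨h, h'⟩ := huv
    · left
      omega
    obtain k | ⟨k, k'⟩ := hvw
    · left
      omega
    refine .inr ⟨h.trans k, ?_⟩
    obtain h' | ⟨rfl, h'⟩ := h'
    · obtain k' | ⟨rfl, k'⟩ := k'
      · exact .inl (ha h' k')
      · exact .inl h'
    · obtain k' | ⟨rfl, k'⟩ := k'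
      · exact .inl k'
      · exact .inr ⟨rfl, hb h' k'⟩

theorem degLexLT_trichotomy [LinearOrder X] (u v : FreeMagma X) :
    DegLexLT u v ∨ u = v ∨ DegLexLT v u := by
  induction u generalizing v with
  | ih1 x =>
    obtain ⟨y, rfl⟩ | ⟨v₁, v₂, rfl⟩ := eq_mul_cases v
    · rw [degLexLT_of_of, degLexLT_of_of]
      rcases lt_trichotomy x y with h | rfl | h <;> simp [*]
    · exact .inl (degLexLT_of_mul _ _ _)
  | ih2 a b ha hb =>
    obtain ⟨y, rfl⟩ | ⟨v₁, v₂, rfl⟩ := eq_mul_cases v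
    · exact .inr (.inr (degLexLT_of_mul _ _ _))
    · rw [degLexLT_mul_mul, degLexLT_mul_mul, mul_inj_iff]
      rcases lt_trichotomy (a.length + b.length) (v₁.length + v₂.length) with h | h | h
      · exact .inl (.inl h)
      · rcases ha v₁ with h1 | rfl | h1
        · exact .inl (.inr ⟨h, .inl h1⟩)
        · rcases hb v₂ with h2 | rfl | h2
          · exact .inl (.inr ⟨h, .inr ⟨rfl, h2⟩⟩)
          · exact .inr (.inl ⟨rfl, rfl⟩)
          · exact .inr (.inr (.inr ⟨h.symm, .inr ⟨rfl, h2⟩⟩))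
        · exact .inr (.inr (.inr ⟨h.symm, .inl h1⟩))
      · exact .inr (.inr (.inl h))

/-- Non-associative words are linearly ordered by the degree-lexicographical order. -/
noncomputable instance instLinearOrderFreeMagma [LinearOrder X] :
    LinearOrder (FreeMagma X) where
  le := DegLexLE
  lt := DegLexLT
  le_refl u := .inr rfl
  le_trans := by
    rintro u v w (h | rfl) (h' | rfl)
    · exact .inl (h.trans h')
    · exact .inl h
    · exact .inl h'
    · exact .inr rfl
  lt_iff_le_not_ge u v := by
    constructor
    · rintro h
      refine ⟨.inl h, ?_⟩
      rintro (h' | rfl)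
      · exact degLexLT_irrefl _ (h.trans h')
      · exact degLexLT_irrefl _ h
    · rintro ⟨h | rfl, h'⟩
      · exact h
      · exact absurd (.inr rfl) h'
  le_antisymm := by
    rintro u v (h | rfl) (h' | h')
    · exact absurd (h.trans h') (degLexLT_irrefl _)
    all_goals simp_all
  le_total u v := by
    rcases degLexLT_trichotomy u v with h | rfl | h
    · exact .inl (.inl h)
    · exact .inl (.inr rfl)
    · exact .inr (.inl h)
  toDecidableLE := Classical.decRel _

variable [LinearOrder X]

theorem mul_lt_mul_iff {u₁ u₂ v₁ v₂ : FreeMagma X} :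
    u₁ * u₂ < v₁ * v₂ ↔
      u₁.length + u₂.length < v₁.length + v₂.length ∨
      u₁.length + u₂.length = v₁.length + v₂.length ∧ (u₁ < v₁ ∨ u₁ = v₁ ∧ u₂ < v₂) :=
  degLexLT_mul_mul

theorem length_le_of_le {u v : FreeMagma X} (h : u ≤ v) : u.length ≤ v.length := by
  obtain h | rfl := h
  · exact h.length_le
  · exact le_rfl

theorem lt_of_length_lt {u v : FreeMagma X} (h : u.length < v.length) : u < v :=
  DegLexLT.length h

theorem word_mul_lt_mul_right {u v : FreeMagma X} (h : u < v) (w : FreeMagma X) :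
    u * w < v * w := by
  have := length_le_of_le h.le
  rw [mul_lt_mul_iff]
  rcases this.lt_or_eq with h' | h'
  · left
    omega
  · exact .inr ⟨by omega, .inl h⟩

theorem word_mul_lt_mul_left {u v : FreeMagma X} (h : u < v) (w : FreeMagma X) :
    w * u < w * v := by
  have := length_le_of_le h.le
  rw [mul_lt_mul_iff]
  rcases this.lt_or_eq with h' | h'
  · left
    omega
  · exact .inr ⟨by omega, .inr ⟨rfl, h⟩⟩

theorem word_mul_le_mul {u v u' v' : FreeMagma X} (h : u ≤ v) (h' : u' ≤ v') :
    u * u' ≤ v * v' := by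
  have h1 : u * u' ≤ v * u' := by
    rcases h.lt_or_eq with h | rfl
    · exact (word_mul_lt_mul_right h _).le
    · exact le_rfl
  have h2 : v * u' ≤ v * v' := by
    rcases h'.lt_or_eq with h | rfl
    · exact (word_mul_lt_mul_left h _).le
    · exact le_rfl
  exact h1.trans h2

/-- Swapping the last two factors so that the larger one comes last lowers a word. -/
theorem mul_mul_swap_lt {a b c : FreeMagma X} (h : c < b) : a * c * b < a * b * c := by
  have := length_le_of_le h.le
  rw [mul_lt_mul_iff]
  refine .inr ⟨?_, .inl (word_mul_lt_mul_left h a)⟩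
  simp only [length_mul]
  omega

/-- Moving brackets to the right lowers a word. -/
theorem mul_lt_mul_mul {a b c m : FreeMagma X} (h : m.length ≤ b.length + c.length) :
    a * m < a * b * c := by
  have := b.length_pos
  rw [mul_lt_mul_iff]
  rcases h.lt_or_eq with h | h
  · left
    simp only [length_mul]
    omega
  · refine .inr ⟨by simp only [length_mul]; omega, .inl (lt_of_length_lt ?_)⟩
    rw [length_mul]
    omega

theorem left_lt_mul (a b : FreeMagma X) : a < a * b :=
  lt_of_length_lt (by have := b.length_pos; rw [length_mul]; omega)

theorem right_lt_mul (a b : FreeMagma X) : b < a * b :=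
  lt_of_length_lt (by have := a.length_pos; rw [length_mul]; omega)

theorem acc_mul_of_acc {u₁ u₂ : FreeMagma X} (h₁ : Acc (· < ·) u₁) (h₂ : Acc (· < ·) u₂)
    (h : ∀ v : FreeMagma X, v.length < u₁.length + u₂.length → Acc (· < ·) v) :
    Acc (· < ·) (u₁ * u₂) := by
  induction h₁ generalizing u₂ with
  | intro u₁ _ ih₁ =>
    induction h₂ with
    | intro u₂ h₂ ih₂ =>
      refine Acc.intro _ fun v hv => ?_
      obtain ⟨y, rfl⟩ | ⟨v₁, v₂, rfl⟩ := eq_mul_cases v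
      · refine h _ ?_
        have := u₁.length_pos
        have := u₂.length_pos
        rw [length_of]
        omega
      · rcases mul_lt_mul_iff.1 hv with hl | ⟨hl, h1 | ⟨rfl, h2⟩⟩
        · exact h _ hl
        · refine ih₁ _ h1 (h _ ?_) ?_
          · have := v₁.length_pos
            omega
          · rwa [hl]
        · refine ih₂ _ h2 ?_
          rwa [hl]

instance instWellFoundedLTFreeMagma [WellFoundedLT X] : WellFoundedLT (FreeMagma X) := by
  have hof : ∀ x : X, Acc (· < ·) (FreeMagma.of x) := by
    intro x
    induction x using WellFoundedLT.induction with
    | ind x ih =>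
      refine Acc.intro _ fun v hv => ?_
      obtain ⟨y, rfl⟩ | ⟨v₁, v₂, rfl⟩ := eq_mul_cases v
      · exact ih y (degLexLT_of_of.1 hv)
      · exact absurd hv (not_degLexLT_mul_of _ _ _)
  have key : ∀ (n : ℕ) (u : FreeMagma X), u.length = n → Acc (· < ·) u := by
    intro n
    induction n using Nat.strong_induction_on with
    | _ n ih =>
      intro u hu
      obtain ⟨y, rfl⟩ | ⟨u₁, u₂, rfl⟩ := eq_mul_cases u
      · exact hof y
      · rw [length_mul] at hu
        have := u₁.length_pos
        have := u₂.length_pos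
        exact acc_mul_of_acc (ih _ (by omega) u₁ rfl) (ih _ (by omega) u₂ rfl)
          fun v hv => ih _ (by omega) v rfl
  exact ⟨⟨fun u => key _ u rfl⟩⟩

end Order

/-! ### Good words -/

section GoodWords

variable {X : Type*} [LinearOrder X]

theorem good_mul_iff {v w : FreeMagma X} :
    Good (v * w) ↔ Good v ∧ Good w ∧ ∀ v₁ v₂, v = v₁ * v₂ → v₂ ≤ w := by
  constructor
  · intro h
    generalize hu : v * w = u at h
    cases h with
    | letter => exact absurd hu.symm (of_ne_mul _ _ _)
    | mul h₁ h₂ h₃ =>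
      obtain ⟨rfl, rfl⟩ := mul_inj_iff.1 hu
      exact ⟨h₁, h₂, h₃⟩
  · rintro ⟨h₁, h₂, h₃⟩
    exact .mul h₁ h₂ h₃

/-- If the product of two good words is not good, then the first factor is a product whose
second factor exceeds the second word. -/
theorem exists_eq_mul_of_not_good {v w : GoodWord X} (h : ¬ Good (v.1 * w.1)) :
    ∃ v₁ v₂ : GoodWord X, v.1 = v₁.1 * v₂.1 ∧ w < v₂ := by
  rw [good_mul_iff] at h
  simp only [v.2, w.2, true_and, not_forall, not_le] at h
  obtain ⟨v₁, v₂, hv, hlt⟩ := h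
  have hg := good_mul_iff.1 (hv ▸ v.2)
  exact ⟨⟨v₁, hg.1⟩, ⟨v₂, hg.2.1⟩, hv, hlt⟩

end GoodWords

/-! ### A right-symmetric multiplication on the span of the good words -/

/-- The vector space on the good words, as the carrier of an algebra. It is a type synonym because
finitely supported functions already carry their pointwise product. -/
def NF (k X : Type*) [Field k] [LT X] : Type _ := GoodWord X →₀ k

namespace NF

section Vector

variable {k X : Type*} [Field k] [LT X]

noncomputable instance : AddCommGroup (NF k X) := inferInstanceAs (AddCommGroup (GoodWord X →₀ k))

noncomputable instance : Module k (NF k X) := inferInstanceAs (Module k (GoodWord X →₀ k))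

/-- The basis of `NF k X` formed by the good words. -/
noncomputable def basis : Module.Basis (GoodWord X) k (NF k X) := .ofRepr (LinearEquiv.refl k _)

/-- A good word, as an element of `NF k X`. -/
noncomputable def word (v : GoodWord X) : NF k X := basis v

/-- The linear extension to `NF k X` of a function on good words. -/
noncomputable def extend {M : Type*} [AddCommGroup M] [Module k M] (t : GoodWord X → M) :
    NF k X →ₗ[k] M := basis.constr k t

theorem extend_word {M : Type*} [AddCommGroup M] [Module k M] (t : GoodWord X → M)
    (v : GoodWord X) : extend (k := k) t (word v) = t v := basis.constr_basis k t v

/-- The span of the good words in `s`. -/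
noncomputable def below (s : Set (GoodWord X)) : Submodule k (NF k X) := Submodule.span k (word '' s)

theorem word_mem_below {s : Set (GoodWord X)} {v : GoodWord X} (h : v ∈ s) :
    (word v : NF k X) ∈ below s := Submodule.subset_span ⟨v, h, rfl⟩

theorem below_mono {s t : Set (GoodWord X)} (h : s ⊆ t) : below (k := k) s ≤ below t :=
  Submodule.span_mono (Set.image_mono h)

@[elab_as_elim]
theorem below_induction {s : Set (GoodWord X)} {P : (f : NF k X) → f ∈ below (k := k) s → Prop}
    (zero : P 0 (zero_mem _)) (word : ∀ v (hv : v ∈ s), P (word v) (word_mem_below hv))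
    (add : ∀ f g hf hg, P f hf → P g hg → P (f + g) (add_mem hf hg))
    (smul : ∀ (c : k) f hf, P f hf → P (c • f) (Submodule.smul_mem _ c hf))
    {f : NF k X} (hf : f ∈ below (k := k) s) : P f hf := by
  refine Submodule.span_induction ?_ zero (fun f g hf hg => add f g hf hg)
    (fun c f hf => smul c f hf) hf
  rintro _ ⟨v, hv, rfl⟩
  exact word v hv

theorem mem_below_univ (f : NF k X) : f ∈ below (k := k) Set.univ := by
  have : Set.range (word (k := k) (X := X)) = Set.range basis := rfl
  rw [below, Set.image_univ, this, basis.span_eq]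
  exact Submodule.mem_top

theorem extend_congr {M : Type*} [AddCommGroup M] [Module k M] {s : Set (GoodWord X)} {f : NF k X}
    (hf : f ∈ below (k := k) s) {t t' : GoodWord X → M} (h : ∀ i ∈ s, t i = t' i) :
    extend t f = extend t' f := by
  induction hf using below_induction with
  | zero => simp
  | word v hv => rw [extend_word, extend_word, h v hv]
  | add f g _ _ hf hg => rw [map_add, map_add, hf, hg]
  | smul c f _ hf => rw [map_smul, map_smul, hf]

theorem extend_mem {M : Type*} [AddCommGroup M] [Module k M] {s : Set (GoodWord X)} {f : NF k X}
    (hf : f ∈ below (k := k) s) {t : GoodWord X → M} {N : Submodule k M} (h : ∀ i ∈ s, t i ∈ N) :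
    extend t f ∈ N := by
  induction hf using below_induction with
  | zero => simp
  | word v hv => rw [extend_word]; exact h v hv
  | add f g _ _ hf hg => rw [map_add]; exact add_mem hf hg
  | smul c f _ hf => rw [map_smul]; exact N.smul_mem c hf

theorem sub_mem_below_length {X : Type*} [LinearOrder X] {f g : NF k X} {v w : FreeMagma X}
    (hf : f ∈ below (k := k) {u : GoodWord X | u.1 ≤ v * w})
    (hg : g ∈ below (k := k) {u : GoodWord X | u.1 ≤ w * v}) :
    f - g ∈ below (k := k) {u : GoodWord X | u.1.length ≤ v.length + w.length} := by
  refine sub_mem (below_mono ?_ hf) (below_mono ?_ hg)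
  · exact fun y hy => length_le_of_le hy
  · exact fun y hy => (length_le_of_le hy).trans (add_comm _ _).le

end Vector

section Mul

variable {k X : Type*} [Field k] [LinearOrder X] [WellFoundedLT X]

open Classical in
/-- The product of two good words, expanded in good words. If the word `v * w` is not good, then
`v = v₁ * v₂` with `w < v₂`, and the product is defined by the right-symmetric identity as
`(v₁ w) v₂ + v₁ (v₂ w - w v₂)`. All products which this expression calls for are attached to words
below `v * w`; the guard in the recursive calls, which records this, is removed in
`basisMul_of_lt`. -/
noncomputable def basisMul (k : Type*) {X : Type*} [Field k] [LinearOrder X] [WellFoundedLT X]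
    (v w : GoodWord X) : NF k X :=
  if h : Good (v.1 * w.1) then word ⟨v.1 * w.1, h⟩ else
    let v₁ := (exists_eq_mul_of_not_good h).choose
    let v₂ := (exists_eq_mul_of_not_good h).choose_spec.choose
    let t : GoodWord X → GoodWord X → NF k X := fun a b =>
      if _h : a.1 * b.1 < v.1 * w.1 then basisMul k a b else 0
    extend (fun u => t u v₂) (t v₁ w) + extend (t v₁) (t v₂ w - t w v₂)
termination_by wellFounded_lt.wrap (v.1 * w.1)

theorem basisMul_of_good {v w : GoodWord X} (h : Good (v.1 * w.1)) :
    basisMul k v w = word ⟨v.1 * w.1, h⟩ := by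
  rw [basisMul, dif_pos h]

theorem exists_basisMul_eq {v w : GoodWord X} (h : ¬ Good (v.1 * w.1)) :
    ∃ v₁ v₂ : GoodWord X, v.1 = v₁.1 * v₂.1 ∧ w < v₂ ∧
      ∀ t : GoodWord X → GoodWord X → NF k X,
        (t = fun a b => if a.1 * b.1 < v.1 * w.1 then basisMul k a b else 0) →
        basisMul k v w = extend (fun u => t u v₂) (t v₁ w) + extend (t v₁) (t v₂ w - t w v₂) := by
  refine ⟨_, _, (exists_eq_mul_of_not_good h).choose_spec.choose_spec.1,
    (exists_eq_mul_of_not_good h).choose_spec.choose_spec.2, ?_⟩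
  rintro t rfl
  rw [basisMul, dif_neg h]
  rfl

theorem basisMul_mem (v w : GoodWord X) :
    basisMul k v w ∈ below (k := k) {u : GoodWord X | u.1 ≤ v.1 * w.1} := by
  induction hm : v.1 * w.1 using WellFoundedLT.induction generalizing v w with
  | ind m ih =>
    subst hm
    by_cases h : Good (v.1 * w.1)
    · rw [basisMul_of_good h]
      exact word_mem_below (le_refl (v.1 * w.1))
    · obtain ⟨v₁, v₂, hv, hlt, ht⟩ := exists_basisMul_eq (k := k) h
      rw [ht _ rfl]
      clear ht
      have hlt : w.1 < v₂.1 := hlt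
      set t : GoodWord X → GoodWord X → NF k X := fun a b =>
        if a.1 * b.1 < v.1 * w.1 then basisMul k a b else 0 with ht_def
      have ht : ∀ a b, t a b ∈ below (k := k) {u : GoodWord X | u.1 ≤ a.1 * b.1} := by
        intro a b
        simp only [ht_def]
        split_ifs with h'
        · exact ih _ h' a b rfl
        · exact zero_mem _
      refine add_mem ?_ ?_
      · refine extend_mem (ht v₁ w) fun u hu => below_mono ?_ (ht u v₂)
        intro y (hy : y.1 ≤ _)
        refine hy.trans ((word_mul_le_mul hu le_rfl).trans ?_)
        rw [hv]
        exact (mul_mul_swap_lt hlt).le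
      · refine extend_mem (sub_mem_below_length (ht v₂ w) (ht w v₂))
          fun u hu => below_mono ?_ (ht v₁ u)
        intro y (hy : y.1 ≤ _)
        refine hy.trans ?_
        rw [hv]
        exact (mul_lt_mul_mul hu).le

theorem basisMul_of_lt {v v₁ v₂ w : GoodWord X} (hv : v.1 = v₁.1 * v₂.1) (hlt : w < v₂) :
    basisMul k v w = extend (fun u => basisMul k u v₂) (basisMul k v₁ w) +
      extend (basisMul k v₁) (basisMul k v₂ w - basisMul k w v₂) := by
  have h : ¬ Good (v.1 * w.1) := fun h =>
    ((good_mul_iff.1 h).2.2 _ _ hv).not_gt hlt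
  obtain ⟨v₁', v₂', hv', -, ht⟩ := exists_basisMul_eq (k := k) h
  obtain ⟨e1, e2⟩ := mul_inj_iff.1 (hv.symm.trans hv')
  obtain rfl := Subtype.ext e1
  obtain rfl := Subtype.ext e2
  have hlt' : w.1 < v₂.1 := hlt
  have hpos := v₁.1.length_pos
  have hswap := mul_mul_swap_lt (a := v₁.1) hlt'
  rw [ht _ rfl]
  simp only [hv]
  rw [if_pos (lt_trans (left_lt_mul _ _) hswap),
    if_pos (lt_of_length_lt (by simp only [length_mul]; omega)),
    if_pos (lt_of_length_lt (by simp only [length_mul]; omega))]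
  congr 1
  · refine extend_congr (basisMul_mem v₁ w) fun u hu => ?_
    rw [if_pos]
    exact (word_mul_le_mul hu le_rfl).trans_lt hswap
  · refine extend_congr (sub_mem_below_length (basisMul_mem v₂ w) (basisMul_mem w v₂))
      fun u hu => ?_
    rw [if_pos]
    exact mul_lt_mul_mul hu

/-- The bilinear extension of `basisMul`. -/
noncomputable def mulHom : NF k X →ₗ[k] NF k X →ₗ[k] NF k X :=
  extend fun v => extend (basisMul k v)

noncomputable instance : NonUnitalNonAssocRing (NF k X) :=
  { (inferInstance : AddCommGroup (NF k X)) with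
    mul := fun f g => mulHom f g
    left_distrib := fun f g h => map_add (mulHom f) g h
    right_distrib := fun f g h => LinearMap.map_add₂ mulHom f g h
    zero_mul := fun f => LinearMap.map_zero₂ mulHom f
    mul_zero := fun f => map_zero (mulHom f) }

theorem mul_def (f g : NF k X) : f * g = mulHom f g := rfl

instance : IsScalarTower k (NF k X) (NF k X) :=
  ⟨fun c f g => LinearMap.map_smul₂ mulHom c f g⟩

instance : SMulCommClass k (NF k X) (NF k X) :=
  ⟨fun c f g => (map_smul (mulHom f) c g).symm⟩

theorem word_mul (v : GoodWord X) (f : NF k X) : word v * f = extend (basisMul k v) f := by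
  rw [mul_def, mulHom, extend_word]

theorem word_mul_word (v w : GoodWord X) : (word v * word w : NF k X) = basisMul k v w := by
  rw [word_mul, extend_word]

theorem mul_word (f : NF k X) (w : GoodWord X) :
    f * word w = extend (fun v => basisMul k v w) f := by
  induction mem_below_univ f using below_induction with
  | zero => simp
  | word v hv => rw [extend_word, word_mul_word]
  | add f g _ _ hf hg => rw [add_mul, map_add, hf, hg]
  | smul c f _ hf => rw [smul_mul_assoc, map_smul, hf]

theorem word_mul_word_mem (v w : GoodWord X) :
    (word v * word w : NF k X) ∈ below (k := k) {u : GoodWord X | u.1 ≤ v.1 * w.1} := by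
  rw [word_mul_word]
  exact basisMul_mem v w

theorem word_mul_word_of_good {v w : GoodWord X} (h : Good (v.1 * w.1)) :
    (word v * word w : NF k X) = word ⟨v.1 * w.1, h⟩ := by
  rw [word_mul_word, basisMul_of_good h]

theorem word_mul_word_of_lt {v v₁ v₂ w : GoodWord X} (hv : v.1 = v₁.1 * v₂.1) (hlt : w < v₂) :
    (word v * word w : NF k X) =
      word v₁ * word w * word v₂ + word v₁ * (word v₂ * word w - word w * word v₂) := by
  rw [mul_word _ v₂, word_mul_word, word_mul_word, word_mul_word, word_mul_word, word_mul,
    basisMul_of_lt hv hlt]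

/-- The right-symmetric identity for the triple `(f, g, h)`. -/
def IsRightSymm (f g h : NF k X) : Prop :=
  f * g * h - f * (g * h) = f * h * g - f * (h * g)

theorem IsRightSymm.symm {f g h : NF k X} (H : IsRightSymm f g h) : IsRightSymm f h g :=
  Eq.symm H

/-- The right-symmetric identity is trilinear. -/
theorem isRightSymm_of_mem_below {s₁ s₂ s₃ : Set (GoodWord X)}
    (H : ∀ a ∈ s₁, ∀ b ∈ s₂, ∀ c ∈ s₃, IsRightSymm (word a : NF k X) (word b) (word c))
    {f g h : NF k X} (hf : f ∈ below (k := k) s₁) (hg : g ∈ below (k := k) s₂)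
    (hh : h ∈ below (k := k) s₃) : IsRightSymm f g h := by
  simp only [IsRightSymm] at *
  induction hf using below_induction with
  | zero => simp
  | word a ha =>
    induction hg using below_induction with
    | zero => simp
    | word b hb =>
      induction hh using below_induction with
      | zero => simp
      | word c hc => exact H a ha b hb c hc
      | add f g _ _ hf hg =>
        simp only [mul_add, add_mul, add_sub_add_comm, hf, hg]
      | smul c f _ hf => simp only [smul_mul_assoc, mul_smul_comm, ← smul_sub, hf]
    | add f g _ _ hf hg =>
      simp only [mul_add, add_mul, add_sub_add_comm, hf, hg]
    | smul c f _ hf => simp only [smul_mul_assoc, mul_smul_comm, ← smul_sub, hf]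
  | add f g _ _ hf hg =>
    simp only [add_mul, add_sub_add_comm, hf, hg]
  | smul c f _ hf => simp only [smul_mul_assoc, ← smul_sub, hf]

/-- The Jacobi identity for commutators, from the right-symmetric identity for the cyclic
permutations of three elements. -/
theorem jacobi_of_isRightSymm {a b c : NF k X} (h₁ : IsRightSymm a b c) (h₂ : IsRightSymm b c a)
    (h₃ : IsRightSymm c a b) :
    ((a * b - b * a) * c - c * (a * b - b * a)) - ((a * c - c * a) * b - b * (a * c - c * a)) =
      a * (b * c - c * b) - (b * c - c * b) * a := by
  simp only [IsRightSymm, sub_mul, mul_sub] at *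
  linear_combination (norm := abel) h₁ + h₂ + h₃

/-- Induction step for the right-symmetric identity at a good word `a = a₁ * a₂`: it follows from
instances of the identity for smaller triples, as the Jacobi identity does in the proof of the
Poincaré–Birkhoff–Witt theorem. -/
theorem isRightSymm_step {a a₁ a₂ b c : NF k X} (ha : a = a₁ * a₂)
    (hab : a * b = a₁ * b * a₂ + a₁ * (a₂ * b - b * a₂))
    (hac : a * c = a₁ * c * a₂ + a₁ * (a₂ * c - c * a₂))
    (h₁ : IsRightSymm (a₁ * b) a₂ c) (h₂ : IsRightSymm a₁ (a₂ * b - b * a₂) c)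
    (h₃ : IsRightSymm (a₁ * c) a₂ b) (h₄ : IsRightSymm a₁ (a₂ * c - c * a₂) b)
    (h₅ : IsRightSymm a₁ b c) (h₆ : IsRightSymm a₁ a₂ (b * c - c * b))
    (j₁ : IsRightSymm a₂ b c) (j₂ : IsRightSymm b c a₂) (j₃ : IsRightSymm c a₂ b) :
    IsRightSymm a b c := by
  have J := congrArg (a₁ * ·) (jacobi_of_isRightSymm j₁ j₂ j₃)
  have h₅' := congrArg (· * a₂) h₅
  unfold IsRightSymm
  rw [hab, hac, ha]
  simp only [IsRightSymm, sub_mul, mul_sub, add_mul] at *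
  linear_combination (norm := abel) h₁ + h₂ - h₃ - h₄ + h₅' - h₆ + J

theorem commutator_mem (v w : GoodWord X) :
    (word v * word w - word w * word v : NF k X) ∈
      below (k := k) {u : GoodWord X | u.1.length ≤ v.1.length + w.1.length} :=
  sub_mem_below_length (word_mul_word_mem v w) (word_mul_word_mem w v)

theorem isRightSymm_of_lt {a b c : GoodWord X} (hcb : c < b)
    (hlen : ∀ a' b' c' : GoodWord X,
      a'.1.length + b'.1.length + c'.1.length < a.1.length + b.1.length + c.1.length →
        IsRightSymm (word a' : NF k X) (word b') (word c'))
    (hlt : ∀ a' b' c' : GoodWord X,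
      a'.1.length + b'.1.length + c'.1.length ≤ a.1.length + b.1.length + c.1.length → a' < a →
        IsRightSymm (word a' : NF k X) (word b') (word c')) :
    IsRightSymm (word a : NF k X) (word b) (word c) := by
  by_cases hgood : Good (a.1 * b.1)
  · have h := word_mul_word_of_lt (k := k) (v := ⟨a.1 * b.1, hgood⟩) rfl hcb
    rw [IsRightSymm, word_mul_word_of_good hgood, h, mul_sub]
    abel
  obtain ⟨a₁, a₂, ha, hba⟩ := exists_eq_mul_of_not_good hgood
  have hba' : b.1 < a₂.1 := hba
  have hca' : c.1 < a₂.1 := hcb.trans hba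
  have ha₁ : a₁ < a := show a₁.1 < a.1 from ha ▸ left_lt_mul _ _
  have hgood' : Good (a₁.1 * a₂.1) := ha ▸ a.2
  have hword : (word a : NF k X) = word a₁ * word a₂ := by
    rw [word_mul_word_of_good hgood']
    congr 1
    exact Subtype.ext ha
  have hal : a.1.length = a₁.1.length + a₂.1.length := by rw [ha, length_mul]
  have hpos := a₁.1.length_pos
  rw [hal] at hlen hlt
  have self (u : GoodWord X) : (word u : NF k X) ∈ below (k := k) {u} := word_mem_below rfl
  -- the instances of the identity whose first entry is `a₁`
  have first {d : GoodWord X} {n : ℕ} {g : NF k X}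
      (hg : g ∈ below (k := k) {u : GoodWord X | u.1.length ≤ n})
      (hn : n + d.1.length ≤ a₂.1.length + b.1.length + c.1.length) :
      IsRightSymm (word a₁) g (word d) := by
    refine isRightSymm_of_mem_below ?_ (self a₁) hg (self d)
    rintro _ rfl e (he : e.1.length ≤ n) _ rfl
    exact hlt _ _ _ (by omega) ha₁
  -- the instances of the identity whose first entry is `a₁ d` for `d < a₂`
  have second {d e : GoodWord X} (hd : d.1 < a₂.1)
      (hn : d.1.length + e.1.length ≤ b.1.length + c.1.length) :
      IsRightSymm (word a₁ * word d : NF k X) (word a₂) (word e) := by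
    refine isRightSymm_of_mem_below ?_ (word_mul_word_mem a₁ d) (self a₂) (self e)
    rintro u (hu : u.1 ≤ a₁.1 * d.1) _ rfl _ rfl
    have := length_le_of_le hu
    rw [length_mul] at this
    refine hlt _ _ _ (by omega) (show u.1 < a.1 from ?_)
    rw [ha]
    exact hu.trans_lt (word_mul_lt_mul_left hd _)
  refine isRightSymm_step hword (word_mul_word_of_lt ha hba)
    (word_mul_word_of_lt ha (hcb.trans hba))
    (second hba' le_rfl) (first (commutator_mem _ _) (by omega))
    (second hca' (by omega)) (first (commutator_mem _ _) (by omega))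
    (hlt _ _ _ (by omega) ha₁) (first (commutator_mem _ _) (by omega)).symm
    (hlen _ _ _ (by omega)) (hlen _ _ _ (by omega)) (hlen _ _ _ (by omega))

/-- The algebra `NF k X` is right-symmetric. -/
theorem isRightSymm (f g h : NF k X) : IsRightSymm f g h := by
  suffices H : ∀ (n : ℕ) (a b c : GoodWord X), a.1.length + b.1.length + c.1.length ≤ n →
      IsRightSymm (word a : NF k X) (word b) (word c) from
    isRightSymm_of_mem_below (fun a _ b _ c _ => H _ a b c le_rfl)
      (mem_below_univ f) (mem_below_univ g) (mem_below_univ h)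
  intro n
  induction n with
  | zero =>
    intro a b c h
    have := a.1.length_pos
    omega
  | succ n ihn =>
  intro a
  induction hm : a.1 using WellFoundedLT.induction generalizing a with
  | ind m ihm =>
  subst hm
  intro b c hn
  have hlen : ∀ a' b' c' : GoodWord X,
      a'.1.length + b'.1.length + c'.1.length < a.1.length + b.1.length + c.1.length →
        IsRightSymm (word a' : NF k X) (word b') (word c') :=
    fun a' b' c' h => ihn a' b' c' (by omega)
  have hlt : ∀ a' b' c' : GoodWord X,
      a'.1.length + b'.1.length + c'.1.length ≤ a.1.length + b.1.length + c.1.length → a' < a →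
        IsRightSymm (word a' : NF k X) (word b') (word c') :=
    fun a' b' c' h ha => ihm a'.1 ha a' rfl b' c' (h.trans hn)
  rcases lt_trichotomy c b with h | rfl | h
  · exact isRightSymm_of_lt h hlen hlt
  · rfl
  · refine (isRightSymm_of_lt h ?_ ?_).symm
    · exact fun a' b' c' h => hlen _ _ _ (by omega)
    · exact fun a' b' c' h => hlt _ _ _ (by omega)

end Mul

end NF

/-! ### The good words form a basis of the free right-symmetric algebra -/

section Basis

variable {k X : Type*} [Field k]

theorem subset_algIdeal {A : Type*} [NonUnitalNonAssocRing A] [Module k A] (s : Set A) :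
    s ⊆ algIdeal k s := fun _ hx => by
  rw [algIdeal, SetLike.mem_coe, Submodule.mem_sInf]
  exact fun I hI => hI.1 hx

theorem algIdeal_le {A : Type*} [NonUnitalNonAssocRing A] [Module k A] {s : Set A}
    {I : Submodule k A} (hs : s ⊆ I) (hI : ∀ x ∈ I, ∀ a : A, a * x ∈ I ∧ x * a ∈ I) :
    algIdeal k s ≤ I := sInf_le ⟨hs, hI⟩

theorem word_mul (v w : FreeMagma X) : word k (v * w) = word k v * word k w := by
  rw [word, word, word, ← AlgQuot.mk_mul, MonoidAlgebra.single_mul_single, mul_one]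

/-- The right-symmetric identity, solved for its leading product. -/
theorem RS.mul_mul_eq (x y z : RS k X) : x * y * z = x * z * y + x * (y * z - z * y) := by
  obtain ⟨x, rfl⟩ := AlgQuot.mk_surjective k _ x
  obtain ⟨y, rfl⟩ := AlgQuot.mk_surjective k _ y
  obtain ⟨z, rfl⟩ := AlgQuot.mk_surjective k _ z
  simp only [← AlgQuot.mk_mul, ← map_add, ← map_sub]
  rw [AlgQuot.mk_eq_mk]
  refine subset_algIdeal _ ⟨x, y, z, ?_⟩
  simp only [associator, mul_sub]
  abel

variable [LinearOrder X]

/-- The span in `RS⟨X⟩` of the good words in `s`. -/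
noncomputable def goodSpan (k : Type*) {X : Type*} [Field k] [LinearOrder X]
    (s : Set (GoodWord X)) : Submodule k (RS k X) :=
  Submodule.span k ((fun v : GoodWord X => word k v.1) '' s)

theorem word_mem_goodSpan {s : Set (GoodWord X)} {v : GoodWord X} (h : v ∈ s) :
    word k v.1 ∈ goodSpan k s := Submodule.subset_span ⟨v, h, rfl⟩

theorem goodSpan_mono {s t : Set (GoodWord X)} (h : s ⊆ t) : goodSpan k s ≤ goodSpan k t :=
  Submodule.span_mono (Set.image_mono h)

/-- To check where the products `f * g` lie it suffices to check products of generators. -/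
theorem mul_mem_of_mem_span {A : Type*} [NonUnitalNonAssocRing A] [Module k A]
    [IsScalarTower k A A] [SMulCommClass k A A] {s t : Set A} {N : Submodule k A}
    (H : ∀ x ∈ s, ∀ y ∈ t, x * y ∈ N) {f g : A} (hf : f ∈ Submodule.span k s)
    (hg : g ∈ Submodule.span k t) : f * g ∈ N := by
  induction hf using Submodule.span_induction with
  | mem x hx =>
    induction hg using Submodule.span_induction with
    | mem y hy => exact H x hx y hy
    | zero => simp
    | add f g _ _ hf hg => rw [mul_add]; exact add_mem hf hg
    | smul c f _ hf => rw [mul_smul_comm]; exact N.smul_mem c hf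
  | zero => simp
  | add f g _ _ hf hg => rw [add_mul]; exact add_mem hf hg
  | smul c f _ hf => rw [smul_mul_assoc]; exact N.smul_mem c hf

theorem mul_mem_of_mem_goodSpan {s t : Set (GoodWord X)} {N : Submodule k (RS k X)}
    (H : ∀ v ∈ s, ∀ w ∈ t, word k v.1 * word k w.1 ∈ N) {f g : RS k X}
    (hf : f ∈ goodSpan k s) (hg : g ∈ goodSpan k t) : f * g ∈ N := by
  refine mul_mem_of_mem_span ?_ hf hg
  rintro _ ⟨v, hv, rfl⟩ _ ⟨w, hw, rfl⟩
  exact H v hv w hw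

/-- The span of the good words that are at most the word `m`. -/
noncomputable def goodLE (k : Type*) {X : Type*} [Field k] [LinearOrder X]
    (m : FreeMagma X) : Submodule k (RS k X) :=
  goodSpan k {v : GoodWord X | v.1 ≤ m}

/-- The span of the good words that are smaller than the word `m`. -/
noncomputable def goodLT (k : Type*) {X : Type*} [Field k] [LinearOrder X]
    (m : FreeMagma X) : Submodule k (RS k X) :=
  goodSpan k {v : GoodWord X | v.1 < m}

theorem goodLE_le_goodLT {m n : FreeMagma X} (h : m < n) : goodLE k m ≤ goodLT k n :=
  goodSpan_mono fun _ hv => lt_of_le_of_lt hv h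

theorem goodLE_mono {m n : FreeMagma X} (h : m ≤ n) : goodLE k m ≤ goodLE k n :=
  goodSpan_mono fun _ hv => le_trans hv h

theorem goodLT_le_goodLE (m : FreeMagma X) : goodLT k m ≤ goodLE k m :=
  goodSpan_mono fun v (hv : v.1 < m) => hv.le

variable [WellFoundedLT X]

/-- Every word is a linear combination of good words that do not exceed it. -/
theorem word_mem_goodLE (m : FreeMagma X) : word k m ∈ goodLE k m := by
  induction m using WellFoundedLT.induction with
  | ind m ih =>
  obtain ⟨x, rfl⟩ | ⟨m₁, m₂, rfl⟩ := eq_mul_cases m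
  · exact word_mem_goodSpan (v := ⟨_, .letter x⟩) (le_refl (FreeMagma.of x))
  rw [word_mul]
  refine mul_mem_of_mem_goodSpan (fun v hv w hw => ?_) (ih _ (left_lt_mul _ _))
    (ih _ (right_lt_mul _ _))
  have hle : v.1 * w.1 ≤ m₁ * m₂ := word_mul_le_mul hv hw
  refine goodLE_mono hle ?_
  obtain hlt | heq := hle.lt_or_eq
  · rw [← word_mul]
    exact ih _ hlt
  by_cases hgood : Good (v.1 * w.1)
  · rw [← word_mul]
    exact word_mem_goodSpan (v := ⟨_, hgood⟩) (le_refl (v.1 * w.1))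
  obtain ⟨v₁, v₂, hv', hlt⟩ := exists_eq_mul_of_not_good hgood
  have low (n : FreeMagma X) (hn : n < v.1 * w.1) : word k n ∈ goodLE k (v.1 * w.1) :=
    goodLE_mono hn.le (ih n (heq ▸ hn))
  rw [hv'] at low ⊢
  rw [word_mul v₁.1, RS.mul_mul_eq, mul_sub]
  simp only [← word_mul]
  refine add_mem (low _ (mul_mul_swap_lt hlt)) (sub_mem (low _ (mul_lt_mul_mul ?_))
    (low _ (mul_lt_mul_mul ?_)))
  · exact (length_mul _ _).le
  · rw [length_mul, add_comm]

theorem mul_mem_goodLE {m n : FreeMagma X} {f g : RS k X} (hf : f ∈ goodLE k m)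
    (hg : g ∈ goodLE k n) : f * g ∈ goodLE k (m * n) :=
  mul_mem_of_mem_goodSpan (fun v hv w hw => by
    rw [← word_mul]
    exact goodLE_mono (word_mul_le_mul hv hw) (word_mem_goodLE _)) hf hg

theorem mul_word_mem_goodLT {m : FreeMagma X} {f : RS k X} (hf : f ∈ goodLT k m)
    (w : GoodWord X) : f * word k w.1 ∈ goodLT k (m * w.1) :=
  mul_mem_of_mem_goodSpan (t := {w}) (fun v hv w' hw' => by
    rw [← word_mul, Set.mem_singleton_iff.1 hw']
    exact goodLE_le_goodLT (word_mul_lt_mul_right hv _) (word_mem_goodLE _)) hf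
    (word_mem_goodSpan rfl)

theorem word_mul_mem_goodLT {m : FreeMagma X} {f : RS k X} (hf : f ∈ goodLT k m)
    (w : GoodWord X) : word k w.1 * f ∈ goodLT k (w.1 * m) :=
  mul_mem_of_mem_goodSpan (s := {w}) (fun w' hw' v hv => by
    rw [← word_mul, Set.mem_singleton_iff.1 hw']
    exact goodLE_le_goodLT (word_mul_lt_mul_left hv _) (word_mem_goodLE _))
    (word_mem_goodSpan rfl) hf

theorem span_word_eq_top :
    Submodule.span k (Set.range fun v : GoodWord X => word k v.1) = ⊤ := by
  have key : ∀ f : FreeNonUnitalNonAssocAlgebra k X,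
      AlgQuot.mk k (rightSymmetricRelators k X) f ∈ goodSpan k (Set.univ : Set (GoodWord X)) := by
    intro f
    induction f using MonoidAlgebra.induction_linear with
    | zero => simp
    | add f g hf hg => rw [map_add]; exact add_mem hf hg
    | single m c =>
      have : MonoidAlgebra.single m c = c • MonoidAlgebra.single m (1 : k) := by simp
      rw [this, map_smul]
      exact Submodule.smul_mem _ _ (goodSpan_mono (Set.subset_univ _) (word_mem_goodLE m))
  rw [eq_top_iff]
  rintro f -
  obtain ⟨f, rfl⟩ := AlgQuot.mk_surjective k _ f
  have := key f
  rwa [goodSpan, Set.image_univ] at this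

/-- The homomorphism from the free non-associative algebra to the model `NF k X` which fixes the
letters. -/
noncomputable def freeToNF : FreeNonUnitalNonAssocAlgebra k X →ₙₐ[k] NF k X :=
  FreeNonUnitalNonAssocAlgebra.lift k fun x => NF.word ⟨FreeMagma.of x, .letter x⟩

theorem algIdeal_le_ker_freeToNF :
    algIdeal k (rightSymmetricRelators k X) ≤
      LinearMap.ker (freeToNF (k := k) (X := X) : _ →ₗ[k] NF k X) := by
  refine algIdeal_le ?_ ?_
  · rintro _ ⟨x, y, z, rfl⟩
    have h := NF.isRightSymm (freeToNF x) (freeToNF y) (freeToNF (k := k) (X := X) z)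
    simp only [NF.IsRightSymm] at h
    simp [associator, h]
  · intro x hx a
    simp only [LinearMap.mem_ker, LinearMap.coe_coe] at hx ⊢
    simp [hx]

/-- The homomorphism from the free right-symmetric algebra to the model `NF k X` which fixes the
letters. -/
noncomputable def RS.toNF : RS k X →ₗ[k] NF k X :=
  (algIdeal k (rightSymmetricRelators k X)).liftQ
    (freeToNF (k := k) (X := X) : _ →ₗ[k] NF k X) algIdeal_le_ker_freeToNF

theorem RS.toNF_mk (f : FreeNonUnitalNonAssocAlgebra k X) :
    RS.toNF (AlgQuot.mk k _ f) = freeToNF f := rfl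

theorem RS.toNF_word (v : GoodWord X) : RS.toNF (word k v.1) = NF.word v := by
  obtain ⟨v, hv⟩ := v
  rw [word, RS.toNF_mk]
  induction v with
  | ih1 x => exact FreeNonUnitalNonAssocAlgebra.lift_of_apply k _ x
  | ih2 a b iha ihb =>
    obtain ⟨ha, hb, -⟩ := good_mul_iff.1 hv
    have : (MonoidAlgebra.single (a * b) 1 : FreeNonUnitalNonAssocAlgebra k X) =
        MonoidAlgebra.single a 1 * MonoidAlgebra.single b 1 := by
      rw [MonoidAlgebra.single_mul_single, mul_one]
    rw [this, map_mul, iha ha, ihb hb]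
    exact NF.word_mul_word_of_good hv

theorem linearIndependent_word :
    LinearIndependent k fun v : GoodWord X => word k v.1 := by
  refine LinearIndependent.of_comp RS.toNF ?_
  have : (RS.toNF ∘ fun v : GoodWord X => word k v.1) = NF.basis (k := k) :=
    funext RS.toNF_word
  rw [this]
  exact NF.basis.linearIndependent

/-- The basis of the free right-symmetric algebra formed by the good words. -/
noncomputable def goodBasis (k X : Type*) [Field k] [LinearOrder X] [WellFoundedLT X] :
    Module.Basis (GoodWord X) k (RS k X) :=
  .mk linearIndependent_word span_word_eq_top.ge

theorem goodBasis_apply (v : GoodWord X) : goodBasis k X v = word k v.1 :=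
  Module.Basis.mk_apply _ _ v

theorem goodBasis_repr_word (v : GoodWord X) :
    (goodBasis k X).repr (word k v.1) = Finsupp.single v 1 := by
  rw [← goodBasis_apply, Module.Basis.repr_self]

theorem mem_goodSpan_iff {s : Set (GoodWord X)} {f : RS k X} :
    f ∈ goodSpan k s ↔ ∀ v, (goodBasis k X).repr f v ≠ 0 → v ∈ s := by
  have : (fun v : GoodWord X => word k v.1) = goodBasis k X :=
    funext fun v => (goodBasis_apply v).symm
  rw [goodSpan, this, Module.Basis.mem_span_image]
  simp [Set.subset_def]

end Basis

/-! ### Leading words -/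

section LeadingWords

variable {k X : Type*} [Field k] [LinearOrder X] [WellFoundedLT X]

theorem hasLeadingTerm_iff {f : RS k X} {w : GoodWord X} {a : k} :
    HasLeadingTerm f w a ↔ a ≠ 0 ∧ (goodBasis k X).repr f w = a ∧ f ∈ goodLE k w.1 := by
  constructor
  · rintro ⟨c, rfl, hc, ha, hle⟩
    have h : (goodBasis k X).repr (c.sum fun v b => b • word k v.1) = c := by
      have e : (c.sum fun v b => b • word k v.1) =
          Finsupp.linearCombination k (goodBasis k X) c := by
        simp only [Finsupp.linearCombination_apply, goodBasis_apply]
      rw [e, Module.Basis.repr_linearCombination]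
    refine ⟨ha, by rw [h, hc], mem_goodSpan_iff.2 fun v hv => ?_⟩
    rw [h] at hv
    exact hle v (Finsupp.mem_support_iff.2 hv)
  · rintro ⟨ha, hw, hf⟩
    refine ⟨(goodBasis k X).repr f, ?_, hw, ha, fun v hv => ?_⟩
    · simpa only [Finsupp.linearCombination_apply, goodBasis_apply] using
        ((goodBasis k X).linearCombination_repr f).symm
    · exact mem_goodSpan_iff.1 hf v (Finsupp.mem_support_iff.1 hv)

theorem isLeadingWord_iff {f : RS k X} {w : GoodWord X} :
    IsLeadingWord f w ↔ (goodBasis k X).repr f w ≠ 0 ∧ f ∈ goodLE k w.1 := by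
  simp only [IsLeadingWord, hasLeadingTerm_iff]
  constructor
  · rintro ⟨a, ha, rfl, h⟩
    exact ⟨ha, h⟩
  · rintro ⟨h1, h2⟩
    exact ⟨_, h1, rfl, h2⟩

theorem IsLeadingWord.unique {f : RS k X} {v w : GoodWord X} (hv : IsLeadingWord f v)
    (hw : IsLeadingWord f w) : v = w := by
  rw [isLeadingWord_iff] at hv hw
  exact Subtype.ext (le_antisymm (mem_goodSpan_iff.1 hw.2 v hv.1) (mem_goodSpan_iff.1 hv.2 w hw.1))

theorem IsLeadingWord.ne_zero {f : RS k X} {v : GoodWord X} (hv : IsLeadingWord f v) :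
    f ≠ 0 := by
  rintro rfl
  exact (isLeadingWord_iff.1 hv).1 (by simp)

theorem exists_isLeadingWord {f : RS k X} (hf : f ≠ 0) : ∃ w, IsLeadingWord f w := by
  have hs : ((goodBasis k X).repr f).support.Nonempty := by
    simpa [Finsupp.support_nonempty_iff] using hf
  obtain ⟨w, hw, hmax⟩ := Finset.exists_max_image _ (fun v : GoodWord X => v.1) hs
  exact ⟨w, isLeadingWord_iff.2 ⟨Finsupp.mem_support_iff.1 hw, mem_goodSpan_iff.2 fun v hv =>
    hmax v (Finsupp.mem_support_iff.2 hv)⟩⟩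

/-- The leading word of a nonzero combination of words below `m` is below `m`. -/
theorem IsLeadingWord.lt_of_mem_goodLT {f : RS k X} {v : GoodWord X} (hv : IsLeadingWord f v)
    {m : FreeMagma X} (hf : f ∈ goodLT k m) : v.1 < m :=
  mem_goodSpan_iff.1 hf v (isLeadingWord_iff.1 hv).1

theorem IsLeadingWord.le_of_mem_goodLE {f : RS k X} {v : GoodWord X} (hv : IsLeadingWord f v)
    {m : FreeMagma X} (hf : f ∈ goodLE k m) : v.1 ≤ m :=
  mem_goodSpan_iff.1 hf v (isLeadingWord_iff.1 hv).1

theorem sub_smul_mem_goodLT {f p : RS k X} {w : GoodWord X} (hf : f ∈ goodLE k w.1)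
    (hp : p - word k w.1 ∈ goodLT k w.1) :
    f - (goodBasis k X).repr f w • p ∈ goodLT k w.1 := by
  have h : f - (goodBasis k X).repr f w • word k w.1 ∈ goodLT k w.1 := by
    refine mem_goodSpan_iff.2 fun v hv => ?_
    rw [map_sub, map_smul, goodBasis_repr_word, Finsupp.sub_apply, Finsupp.smul_apply,
      Finsupp.single_apply] at hv
    split_ifs at hv with hvw
    · subst hvw
      simp at hv
    · have hle : v.1 ≤ w.1 := mem_goodSpan_iff.1 hf v (by simpa using hv)
      exact lt_of_le_of_ne hle fun h => hvw (Subtype.ext h.symm)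
  have := sub_mem h ((goodLT k w.1).smul_mem ((goodBasis k X).repr f w) hp)
  rwa [smul_sub, sub_sub_sub_cancel_right] at this

theorem isLeadingWord_of_sub_mem {f : RS k X} {w : GoodWord X}
    {c : k} (hc : c ≠ 0) (h : f - c • word k w.1 ∈ goodLT k w.1) : IsLeadingWord f w := by
  have hf : f = (f - c • word k w.1) + c • word k w.1 := by abel
  refine isLeadingWord_iff.2 ⟨?_, ?_⟩
  · have h0 : (goodBasis k X).repr (f - c • word k w.1) w = 0 := by
      by_contra h'
      exact lt_irrefl w.1 (mem_goodSpan_iff.1 h w h')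
    rw [hf, map_add, Finsupp.add_apply, h0, map_smul, goodBasis_repr_word]
    simpa using hc
  · rw [hf]
    exact add_mem (goodLT_le_goodLE _ h) (Submodule.smul_mem _ _ (word_mem_goodLE _))

/-- A monic element differs from its leading word by a combination of smaller words. -/
theorem IsMonic.sub_word_mem {f : RS k X} (hf : IsMonic f) {w : GoodWord X}
    (hw : IsLeadingWord f w) : f - word k w.1 ∈ goodLT k w.1 := by
  obtain ⟨w', h⟩ := hf
  obtain rfl := IsLeadingWord.unique ⟨1, h⟩ hw
  obtain ⟨-, h1, h2⟩ := hasLeadingTerm_iff.1 h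
  have := sub_smul_mem_goodLT h2 (p := word k w'.1) (by simp)
  rwa [h1, one_smul] at this

theorem plug_lead {s : RS k X} {t : FreeMagma X} (h : s - word k t ∈ goodLT k t) (c : Ctx X) :
    c.eval s - word k (c.plug t) ∈ goodLT k (c.plug t) := by
  induction c with
  | hole => exact h
  | mulRight c v ih =>
    rw [Ctx.eval, Ctx.plug, word_mul, ← sub_mul]
    exact mul_word_mem_goodLT ih v
  | mulLeft v c ih =>
    rw [Ctx.eval, Ctx.plug, word_mul, ← mul_sub]
    exact word_mul_mem_goodLT ih v

end LeadingWords

/-! ### Right multiplication by a good word is injective -/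

section RootDegree

variable {X : Type*}

/-- The root degree of a word: the number `n` in `w = (⋯((x)(w₁))⋯)(wₙ)`. -/
def rootDegree : FreeMagma X → ℕ
  | .of _ => 0
  | .mul v _ => rootDegree v + 1

theorem rootDegree_mul (v w : FreeMagma X) : rootDegree (v * w) = rootDegree v + 1 := rfl

variable [LinearOrder X]

/-- Insertion of `w` into the increasing sequence `w₁ ≤ ⋯ ≤ wₙ` of a good word
`(⋯((x)(w₁))⋯)(wₙ)`. -/
noncomputable def insertFactor : FreeMagma X → FreeMagma X → FreeMagma X
  | .of x, w => .of x * w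
  | .mul v₁ v₂, w => if w < v₂ then insertFactor v₁ w * v₂ else v₁ * v₂ * w

theorem insertFactor_of (x : X) (w : FreeMagma X) :
    insertFactor (.of x) w = .of x * w := rfl

theorem insertFactor_mul (v₁ v₂ w : FreeMagma X) :
    insertFactor (v₁ * v₂) w = if w < v₂ then insertFactor v₁ w * v₂ else v₁ * v₂ * w := rfl

theorem rootDegree_insertFactor (v w : FreeMagma X) :
    rootDegree (insertFactor v w) = rootDegree v + 1 := by
  induction v with
  | ih1 x => rfl
  | ih2 a b iha _ =>
    rw [insertFactor_mul]
    split_ifs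
    · rw [rootDegree_mul, iha, rootDegree_mul]
    · rfl

theorem insertFactor_eq_mul_self {v w : FreeMagma X} (h : ∀ v₁ v₂, v = v₁ * v₂ → v₂ ≤ w) :
    insertFactor v w = v * w := by
  obtain ⟨x, rfl⟩ | ⟨a, b, rfl⟩ := eq_mul_cases v
  · rfl
  · rw [insertFactor_mul, if_neg (h a b rfl).not_gt]

theorem last_insertFactor {v w a b : FreeMagma X} (h : insertFactor v w = a * b) :
    b = w ∨ ∃ v₁, v = v₁ * b := by
  obtain ⟨x, rfl⟩ | ⟨v₁, v₂, rfl⟩ := eq_mul_cases v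
  · exact .inl (mul_inj_iff.1 h).2.symm
  · rw [insertFactor_mul] at h
    split_ifs at h
    · exact .inr ⟨v₁, by rw [(mul_inj_iff.1 h).2]⟩
    · exact .inl (mul_inj_iff.1 h).2.symm

theorem good_insertFactor {v w : FreeMagma X} (hv : Good v) (hw : Good w) :
    Good (insertFactor v w) := by
  induction v with
  | ih1 x => exact good_mul_iff.2 ⟨hv, hw, fun _ _ h => absurd h (of_ne_mul _ _ _)⟩
  | ih2 a b iha _ =>
    obtain ⟨ha, hb, hab⟩ := good_mul_iff.1 hv
    rw [insertFactor_mul]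
    split_ifs with h
    · refine good_mul_iff.2 ⟨iha ha, hb, fun c d hcd => ?_⟩
      obtain rfl | ⟨a₁, rfl⟩ := last_insertFactor hcd
      · exact h.le
      · exact hab _ _ rfl
    · refine good_mul_iff.2 ⟨hv, hw, fun c d hcd => ?_⟩
      rw [← (mul_inj_iff.1 hcd).2]
      exact not_lt.1 h

theorem insertFactor_left_injective (w : FreeMagma X) :
    Function.Injective fun v => insertFactor v w := by
  intro v
  induction v with
  | ih1 x =>
    intro v' h
    obtain ⟨y, rfl⟩ | ⟨a, b, rfl⟩ := eq_mul_cases v'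
    · exact (mul_inj_iff.1 h).1
    · simp only [insertFactor_of, insertFactor_mul] at h
      split_ifs at h with h'
      · obtain ⟨-, rfl⟩ := mul_inj_iff.1 h
        exact absurd h' (lt_irrefl _)
      · exact (mul_inj_iff.1 h).1
  | ih2 a b iha _ =>
    intro v' h
    obtain ⟨y, rfl⟩ | ⟨a', b', rfl⟩ := eq_mul_cases v'
    · simp only [insertFactor_of, insertFactor_mul] at h
      split_ifs at h with h'
      · obtain ⟨-, rfl⟩ := mul_inj_iff.1 h
        exact absurd h' (lt_irrefl _)
      · exact (mul_inj_iff.1 h).1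
    · simp only [insertFactor_mul] at h
      split_ifs at h with h1 h2 h2
      · obtain ⟨h3, rfl⟩ := mul_inj_iff.1 h
        rw [iha h3]
      · obtain ⟨-, rfl⟩ := mul_inj_iff.1 h
        exact absurd h1 (lt_irrefl _)
      · obtain ⟨-, rfl⟩ := mul_inj_iff.1 h
        exact absurd h2 (lt_irrefl _)
      · exact (mul_inj_iff.1 h).1

variable {k : Type*} [Field k]

/-- The span of the good words of root degree at most `d`. -/
noncomputable def rootDegreeLE (k X : Type*) [Field k] [LinearOrder X] (d : ℕ) :
    Submodule k (RS k X) :=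
  goodSpan k {v : GoodWord X | rootDegree v.1 ≤ d}

theorem rootDegreeLE_mono {d e : ℕ} (h : d ≤ e) : rootDegreeLE k X d ≤ rootDegreeLE k X e :=
  goodSpan_mono fun _ hv => le_trans hv h

variable [WellFoundedLT X]

theorem mem_goodSpan_univ (f : RS k X) : f ∈ goodSpan k (Set.univ : Set (GoodWord X)) :=
  mem_goodSpan_iff.2 fun _ _ => trivial

/-- Up to words of root degree at most that of `v`, the product of `v` and `w` is the good word
obtained by inserting `w` into `v`. -/
theorem word_mul_word_sub_insertFactor_mem (v w : GoodWord X) :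
    word k v.1 * word k w.1 - word k (insertFactor v.1 w.1) ∈
      rootDegreeLE k X (rootDegree v.1) := by
  induction hd : rootDegree v.1 using Nat.strong_induction_on generalizing v w with
  | _ d ih =>
  by_cases hgood : Good (v.1 * w.1)
  · rw [insertFactor_eq_mul_self (good_mul_iff.1 hgood).2.2, word_mul, sub_self]
    exact zero_mem _
  obtain ⟨v₁, v₂, hv, hlt⟩ := exists_eq_mul_of_not_good hgood
  have hlt' : w.1 < v₂.1 := hlt
  have hd' : d = rootDegree v₁.1 + 1 := by rw [← hd, hv, rootDegree_mul]
  have mul_mem {f : RS k X} (hf : f ∈ rootDegreeLE k X (rootDegree v₁.1)) (g : RS k X) :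
      f * g ∈ rootDegreeLE k X d := by
    refine mul_mem_of_mem_goodSpan ?_ hf (mem_goodSpan_univ g)
    rintro u hu u' -
    have hu : rootDegree u.1 ≤ rootDegree v₁.1 := hu
    have h := ih _ (by omega) u u' rfl
    rw [← sub_add_cancel (word k u.1 * word k u'.1) (word k (insertFactor u.1 u'.1))]
    refine add_mem (rootDegreeLE_mono (by omega) h)
      (word_mem_goodSpan (v := ⟨_, good_insertFactor u.2 u'.2⟩)
        (show rootDegree (insertFactor _ _) ≤ d from ?_))
    rw [rootDegree_insertFactor]
    omega
  have h₁ := mul_mem (ih _ (by omega) v₁ w rfl) (word k v₂.1)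
  have h₂ := mul_mem (word_mem_goodSpan (le_refl (rootDegree v₁.1)))
    (word k v₂.1 * word k w.1 - word k w.1 * word k v₂.1)
  rw [hv, insertFactor_mul, if_pos hlt', word_mul, word_mul, RS.mul_mul_eq]
  rw [sub_mul] at h₁
  have := add_mem h₁ h₂
  rwa [sub_add_eq_add_sub] at this

theorem mul_word_ne_zero {f : RS k X} (hf : f ≠ 0) (w : GoodWord X) : f * word k w.1 ≠ 0 := by
  have hs : ((goodBasis k X).repr f).support.Nonempty := by
    simpa [Finsupp.support_nonempty_iff] using hf
  obtain ⟨u₀, hu₀, hmax⟩ := Finset.exists_max_image _ (fun v : GoodWord X => rootDegree v.1) hs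
  have hfd : f ∈ rootDegreeLE k X (rootDegree u₀.1) :=
    mem_goodSpan_iff.2 fun v hv => hmax v (Finsupp.mem_support_iff.2 hv)
  let z : GoodWord X := ⟨_, good_insertFactor u₀.2 w.2⟩
  -- a word of maximal root degree in `f` yields a word of `f * w` with the same coefficient
  have key : ∀ g ∈ rootDegreeLE k X (rootDegree u₀.1),
      (goodBasis k X).repr (g * word k w.1) z = (goodBasis k X).repr g u₀ := by
    intro g hg
    induction hg using Submodule.span_induction with
    | mem g hg =>
      obtain ⟨u, hu, rfl⟩ := hg
      have hu : rootDegree u.1 ≤ rootDegree u₀.1 := hu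
      have h0 : (goodBasis k X).repr
          (word k u.1 * word k w.1 - word k (insertFactor u.1 w.1)) z = 0 := by
        by_contra h
        have h' : rootDegree (insertFactor u₀.1 w.1) ≤ rootDegree u.1 :=
          mem_goodSpan_iff.1 (word_mul_word_sub_insertFactor_mem u w) z h
        rw [rootDegree_insertFactor] at h'
        omega
      have h1 := goodBasis_repr_word (k := k) (⟨_, good_insertFactor u.2 w.2⟩ : GoodWord X)
      have h2 : (⟨_, good_insertFactor u.2 w.2⟩ : GoodWord X) = z ↔ u = u₀ := by
        rw [Subtype.ext_iff, Subtype.ext_iff]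
        exact (insertFactor_left_injective w.1).eq_iff
      rw [map_sub, Finsupp.sub_apply, sub_eq_zero] at h0
      simp only [h0, h1, goodBasis_repr_word, Finsupp.single_apply, h2]
    | zero => simp
    | add f g _ _ hf hg => rw [add_mul, map_add, map_add, Finsupp.add_apply, hf, hg]; rfl
    | smul c f _ hf => rw [smul_mul_assoc, map_smul, map_smul, Finsupp.smul_apply, hf]; rfl
  intro h
  have := key f hfd
  rw [h] at this
  exact Finsupp.mem_support_iff.1 hu₀ (by simpa using this.symm)

end RootDegree

/-! ### Products of normal `S`-words with good words -/

section NormalWords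

variable {k X : Type*} [Field k] [LinearOrder X]

/-- The span of the normal `S`-words whose leading words are at most `m`. -/
noncomputable def normalLE (S : Set (RS k X)) (m : FreeMagma X) : Submodule k (RS k X) :=
  Submodule.span k {p | ∃ v : GoodWord X, IsNormalSWord S p v ∧ v.1 ≤ m}

/-- The span of the normal `S`-words whose leading words are smaller than `m`. -/
noncomputable def normalLT (S : Set (RS k X)) (m : FreeMagma X) : Submodule k (RS k X) :=
  Submodule.span k {p | ∃ v : GoodWord X, IsNormalSWord S p v ∧ v.1 < m}

variable {S : Set (RS k X)}

theorem normalLE_mono {m n : FreeMagma X} (h : m ≤ n) : normalLE S m ≤ normalLE S n :=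
  Submodule.span_mono fun _ ⟨v, hp, hv⟩ => ⟨v, hp, hv.trans h⟩

theorem normalLE_le_normalLT {m n : FreeMagma X} (h : m < n) : normalLE S m ≤ normalLT S n :=
  Submodule.span_mono fun _ ⟨v, hp, hv⟩ => ⟨v, hp, hv.trans_lt h⟩

theorem IsNormalSWord.mem_normalLE {p : RS k X} {w : GoodWord X} (h : IsNormalSWord S p w) :
    p ∈ normalLE S w.1 := Submodule.subset_span ⟨w, h, le_rfl⟩

theorem IsNormalSWord.mul_word {p : RS k X} {z w : GoodWord X} (h : IsNormalSWord S p z)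
    (hg : Good (z.1 * w.1)) : IsNormalSWord S (p * word k w.1) ⟨z.1 * w.1, hg⟩ := by
  obtain ⟨s, hs, t, ht, c, hc, rfl⟩ := h
  exact ⟨s, hs, t, ht, c.mulRight w, by rw [Ctx.plug, hc], rfl⟩

theorem IsNormalSWord.word_mul {p : RS k X} {z w : GoodWord X} (h : IsNormalSWord S p z)
    (hg : Good (w.1 * z.1)) : IsNormalSWord S (word k w.1 * p) ⟨w.1 * z.1, hg⟩ := by
  obtain ⟨s, hs, t, ht, c, hc, rfl⟩ := h
  exact ⟨s, hs, t, ht, c.mulLeft w, by rw [Ctx.plug, hc], rfl⟩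

theorem eval_mem_algIdeal {s : RS k X} (hs : s ∈ S) (c : Ctx X) :
    c.eval s ∈ algIdeal k S := by
  induction c with
  | hole => exact subset_algIdeal S hs
  | mulRight c v ih => exact algIdeal_mul_right k S ih _
  | mulLeft v c ih => exact algIdeal_mul_left k S ih _

theorem IsNormalSWord.mem_algIdeal {p : RS k X} {w : GoodWord X} (h : IsNormalSWord S p w) :
    p ∈ algIdeal k S := by
  obtain ⟨s, hs, t, ht, c, hc, rfl⟩ := h
  exact eval_mem_algIdeal hs c

variable [WellFoundedLT X]

/-- The word attached to a normal `S`-word is its leading word, with coefficient `1`. -/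
theorem IsNormalSWord.sub_word_mem (hS : ∀ s ∈ S, IsMonic s) {p : RS k X} {w : GoodWord X}
    (h : IsNormalSWord S p w) : p - word k w.1 ∈ goodLT k w.1 := by
  obtain ⟨s, hs, t, ht, c, hc, rfl⟩ := h
  rw [← hc]
  exact plug_lead ((hS s hs).sub_word_mem ht) c

theorem IsNormalSWord.mem_goodLE (hS : ∀ s ∈ S, IsMonic s) {p : RS k X} {w : GoodWord X}
    (h : IsNormalSWord S p w) : p ∈ goodLE k w.1 := by
  rw [← sub_add_cancel p (word k w.1)]
  exact add_mem (goodLT_le_goodLE _ (h.sub_word_mem hS)) (word_mem_goodLE _)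

/-- If the right-multiplication compositions are trivial, the product of a normal `S`-word and a
good word, in either order, is a combination of normal `S`-words that do not exceed the product of
the leading words. The induction is on the word `m` which is this product. -/
theorem mul_mem_normalLE_aux (hR : RightMulTrivial S) (m : FreeMagma X) :
    ∀ (p : RS k X) (z w : GoodWord X), IsNormalSWord S p z →
      (z.1 * w.1 = m → p * word k w.1 ∈ normalLE S m) ∧
      (w.1 * z.1 = m → word k w.1 * p ∈ normalLE S m) := by
  induction m using WellFoundedLT.induction with
  | ind m ih =>
  have right {a b : FreeMagma X} {f g : RS k X} (hab : a * b < m) (hf : f ∈ normalLE S a)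
      (hg : g ∈ goodLE k b) : f * g ∈ normalLE S (a * b) := by
    refine mul_mem_of_mem_span ?_ hf hg
    rintro p ⟨z, hp, hz⟩ _ ⟨w, hw, rfl⟩
    have hle := word_mul_le_mul hz hw
    exact normalLE_mono hle ((ih _ (hle.trans_lt hab) p z w hp).1 rfl)
  have left {a b : FreeMagma X} {f g : RS k X} (hab : b * a < m) (hg : g ∈ goodLE k b)
      (hf : f ∈ normalLE S a) : g * f ∈ normalLE S (b * a) := by
    refine mul_mem_of_mem_span ?_ hg hf
    rintro _ ⟨w, hw, rfl⟩ p ⟨z, hp, hz⟩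
    have hle := word_mul_le_mul hw hz
    exact normalLE_mono hle ((ih _ (hle.trans_lt hab) p z w hp).2 rfl)
  intro p z w hp
  constructor
  · rintro rfl
    by_cases hgood : Good (z.1 * w.1)
    · exact (hp.mul_word hgood).mem_normalLE
    obtain ⟨z₁, z₂, hz, hlt⟩ := exists_eq_mul_of_not_good hgood
    have hlt' : w.1 < z₂.1 := hlt
    have hpos := z₁.1.length_pos
    obtain ⟨s, hs, t, ht, c, hc, rfl⟩ := hp
    rw [hz] at hc right left ⊢
    have hswap := mul_mul_swap_lt (a := z₁.1) hlt'
    have hzw := mul_lt_mul_mul (a := z₁.1) (length_mul z₂.1 w.1).le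
    have hwz := mul_lt_mul_mul (a := z₁.1) (b := z₂.1) (c := w.1) (m := w.1 * z₂.1)
      (by rw [length_mul, add_comm])
    cases c with
    | hole =>
      have htz : t.1 = z.1 := hc.trans hz.symm
      obtain ⟨l, hl, hmem⟩ := hR s hs t w ht (htz ▸ hgood)
      have hle : l.1 ≤ z₁.1 * z₂.1 * w.1 := by
        rw [← hz, ← htz]
        exact hl.le_of_mem_goodLE (mul_mem_goodLE (isLeadingWord_iff.1 ht).2 (word_mem_goodLE _))
      exact normalLE_mono hle hmem
    | mulRight c v =>
      obtain ⟨hcz, hv⟩ := mul_inj_iff.1 hc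
      obtain rfl := Subtype.ext hv
      have hq : c.eval s ∈ normalLE S z₁.1 :=
        IsNormalSWord.mem_normalLE ⟨s, hs, t, ht, c, hcz, rfl⟩
      have hvw := mul_mem_goodLE (word_mem_goodLE (k := k) v.1) (word_mem_goodLE w.1)
      have hwv := mul_mem_goodLE (word_mem_goodLE (k := k) w.1) (word_mem_goodLE v.1)
      rw [Ctx.eval, RS.mul_mul_eq, mul_sub]
      refine add_mem (normalLE_mono hswap.le ?_)
        (sub_mem (normalLE_mono hzw.le ?_) (normalLE_mono hwz.le ?_))
      · exact right hswap (right (word_mul_lt_mul_right (left_lt_mul _ _) _) hq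
          (word_mem_goodLE _)) (word_mem_goodLE _)
      · exact right hzw hq hvw
      · exact right hwz hq hwv
    | mulLeft v c =>
      obtain ⟨hv, hcz⟩ := mul_inj_iff.1 hc
      obtain rfl := Subtype.ext hv
      have hq : c.eval s ∈ normalLE S z₂.1 :=
        IsNormalSWord.mem_normalLE ⟨s, hs, t, ht, c, hcz, rfl⟩
      have hvw := mul_mem_goodLE (word_mem_goodLE (k := k) v.1) (word_mem_goodLE w.1)
      rw [Ctx.eval, RS.mul_mul_eq, mul_sub]
      refine add_mem (normalLE_mono hswap.le ?_)
        (sub_mem (normalLE_mono hzw.le ?_) (normalLE_mono hwz.le ?_))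
      · exact left hswap hvw hq
      · exact left hzw (word_mem_goodLE _) (right (word_mul_lt_mul_right (right_lt_mul _ _) _)
          hq (word_mem_goodLE _))
      · exact left hwz (word_mem_goodLE _)
          (left (lt_trans (right_lt_mul _ _) hwz) (word_mem_goodLE _) hq)
  · rintro rfl
    by_cases hgood : Good (w.1 * z.1)
    · exact (hp.word_mul hgood).mem_normalLE
    obtain ⟨w₁, w₂, hw, hlt⟩ := exists_eq_mul_of_not_good hgood
    have hlt' : z.1 < w₂.1 := hlt
    rw [hw] at right left ⊢
    have hswap := mul_mul_swap_lt (a := w₁.1) hlt'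
    have hwz := mul_lt_mul_mul (a := w₁.1) (length_mul w₂.1 z.1).le
    have hzw := mul_lt_mul_mul (a := w₁.1) (b := w₂.1) (c := z.1) (m := z.1 * w₂.1)
      (by rw [length_mul, add_comm])
    have hq := hp.mem_normalLE
    rw [RSAlg.word_mul, RS.mul_mul_eq, mul_sub]
    refine add_mem (normalLE_mono hswap.le ?_)
      (sub_mem (normalLE_mono hwz.le ?_) (normalLE_mono hzw.le ?_))
    · exact right hswap (left (word_mul_lt_mul_right (left_lt_mul _ _) _) (word_mem_goodLE _) hq)
        (word_mem_goodLE _)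
    · exact left hwz (word_mem_goodLE _)
        (left (word_mul_lt_mul_right (right_lt_mul _ _) _) (word_mem_goodLE _) hq)
    · exact left hzw (word_mem_goodLE _)
        (right (lt_trans (right_lt_mul _ _) hzw) hq (word_mem_goodLE _))

theorem IsNormalSWord.mul_word_mem (hR : RightMulTrivial S) {p : RS k X} {z : GoodWord X}
    (hp : IsNormalSWord S p z) (w : GoodWord X) : p * word k w.1 ∈ normalLE S (z.1 * w.1) :=
  (mul_mem_normalLE_aux hR _ p z w hp).1 rfl

theorem IsNormalSWord.word_mul_mem (hR : RightMulTrivial S) {p : RS k X} {z : GoodWord X}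
    (hp : IsNormalSWord S p z) (w : GoodWord X) : word k w.1 * p ∈ normalLE S (w.1 * z.1) :=
  (mul_mem_normalLE_aux hR _ p z w hp).2 rfl

theorem mul_word_mem_normalLT (hR : RightMulTrivial S) {f : RS k X} {m : FreeMagma X}
    (hf : f ∈ normalLT S m) (w : GoodWord X) : f * word k w.1 ∈ normalLT S (m * w.1) := by
  refine mul_mem_of_mem_span ?_ hf (Submodule.mem_span_singleton_self _)
  rintro p ⟨z, hp, hz⟩ _ rfl
  exact normalLE_le_normalLT (word_mul_lt_mul_right hz _) (hp.mul_word_mem hR w)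

theorem word_mul_mem_normalLT (hR : RightMulTrivial S) {f : RS k X} {m : FreeMagma X}
    (hf : f ∈ normalLT S m) (w : GoodWord X) : word k w.1 * f ∈ normalLT S (w.1 * m) := by
  refine mul_mem_of_mem_span ?_ (Submodule.mem_span_singleton_self _) hf
  rintro _ rfl p ⟨z, hp, hz⟩
  exact normalLE_le_normalLT (word_mul_lt_mul_left hz _) (hp.word_mul_mem hR w)

theorem IsNormalSWord.mul_goodLT_mem (hR : RightMulTrivial S) {p : RS k X} {z : GoodWord X}
    (hp : IsNormalSWord S p z) {g : RS k X} {m : FreeMagma X} (hg : g ∈ goodLT k m) :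
    p * g ∈ normalLT S (z.1 * m) := by
  refine mul_mem_of_mem_span ?_ (Submodule.mem_span_singleton_self p) hg
  rintro _ rfl _ ⟨w, hw, rfl⟩
  exact normalLE_le_normalLT (word_mul_lt_mul_left hw _) (hp.mul_word_mem hR w)

theorem IsNormalSWord.goodLT_mul_mem (hR : RightMulTrivial S) {p : RS k X} {z : GoodWord X}
    (hp : IsNormalSWord S p z) {g : RS k X} {m : FreeMagma X} (hg : g ∈ goodLT k m) :
    g * p ∈ normalLT S (m * z.1) := by
  refine mul_mem_of_mem_span ?_ hg (Submodule.mem_span_singleton_self p)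
  rintro _ ⟨w, hw, rfl⟩ _ rfl
  exact normalLE_le_normalLT (word_mul_lt_mul_right hw _) (hp.word_mul_mem hR w)

/-- Two normal `S`-words with the same leading word agree modulo smaller normal `S`-words. If the
distinguished places are nested, this is a composition of inclusion multiplied by good words; if
they are disjoint, one `S`-word at a time is exchanged for its leading word. -/
theorem eval_sub_eval_mem (hS : ∀ s ∈ S, IsMonic s) (hGS : IsGroebnerShirshov S)
    {s₁ s₂ : RS k X} (hs₁ : s₁ ∈ S) (hs₂ : s₂ ∈ S) {t₁ t₂ : GoodWord X}
    (ht₁ : IsLeadingWord s₁ t₁) (ht₂ : IsLeadingWord s₂ t₂) {z : FreeMagma X} (hz : Good z)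
    {c₁ c₂ : Ctx X} (hc₁ : c₁.plug t₁.1 = z) (hc₂ : c₂.plug t₂.1 = z) :
    c₁.eval s₁ - c₂.eval s₂ ∈ normalLT S z := by
  obtain ⟨hI, hR⟩ := hGS
  induction c₁ generalizing c₂ z with
  | hole =>
    have h := hI s₁ hs₁ s₂ hs₂ t₁ t₂ ht₁ ht₂ c₂ (hc₁.trans hc₂.symm)
    rw [← hc₁]
    exact h
  | mulRight c₁ v₁ ih =>
    cases c₂ with
    | hole =>
      have h := hI s₂ hs₂ s₁ hs₁ t₂ t₁ ht₂ ht₁ (c₁.mulRight v₁) (hc₂.trans hc₁.symm)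
      rw [← neg_sub, ← hc₂]
      exact neg_mem h
    | mulRight c₂ v₂ =>
      subst hc₁
      obtain ⟨hc, hv⟩ := mul_inj_iff.1 hc₂
      obtain rfl := Subtype.ext hv
      rw [Ctx.eval, Ctx.eval, ← sub_mul]
      exact mul_word_mem_normalLT hR (ih (good_mul_iff.1 hz).1 rfl hc) v₂
    | mulLeft v₂ c₂ =>
      subst hc₁
      obtain ⟨hv, hc⟩ := mul_inj_iff.1 hc₂
      have h₁ : IsNormalSWord S (c₁.eval s₁) v₂ := ⟨s₁, hs₁, t₁, ht₁, c₁, hv.symm, rfl⟩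
      have h₂ : IsNormalSWord S (c₂.eval s₂) v₁ := ⟨s₂, hs₂, t₂, ht₂, c₂, hc, rfl⟩
      have m₁ := h₂.goodLT_mul_mem hR (h₁.sub_word_mem hS)
      have m₂ := h₁.mul_goodLT_mem hR (h₂.sub_word_mem hS)
      rw [Ctx.plug, ← hv]
      have e : (c₁.mulRight v₁).eval s₁ - (Ctx.mulLeft v₂ c₂).eval s₂ =
          (c₁.eval s₁ - word k v₂.1) * c₂.eval s₂ -
            c₁.eval s₁ * (c₂.eval s₂ - word k v₁.1) := by
        rw [Ctx.eval, Ctx.eval, sub_mul, mul_sub]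
        abel
      rw [e]
      exact sub_mem m₁ m₂
  | mulLeft v₁ c₁ ih =>
    cases c₂ with
    | hole =>
      have h := hI s₂ hs₂ s₁ hs₁ t₂ t₁ ht₂ ht₁ (c₁.mulLeft v₁) (hc₂.trans hc₁.symm)
      rw [← neg_sub, ← hc₂]
      exact neg_mem h
    | mulLeft v₂ c₂ =>
      subst hc₁
      obtain ⟨hv, hc⟩ := mul_inj_iff.1 hc₂
      obtain rfl := Subtype.ext hv
      rw [Ctx.eval, Ctx.eval, ← mul_sub]
      exact word_mul_mem_normalLT hR (ih (good_mul_iff.1 hz).2.1 rfl hc) v₂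
    | mulRight c₂ v₂ =>
      subst hc₁
      obtain ⟨hc, hv⟩ := mul_inj_iff.1 hc₂
      have h₁ : IsNormalSWord S (c₁.eval s₁) v₂ := ⟨s₁, hs₁, t₁, ht₁, c₁, hv.symm, rfl⟩
      have h₂ : IsNormalSWord S (c₂.eval s₂) v₁ := ⟨s₂, hs₂, t₂, ht₂, c₂, hc, rfl⟩
      have m₁ := h₁.goodLT_mul_mem hR (h₂.sub_word_mem hS)
      have m₂ := h₂.mul_goodLT_mem hR (h₁.sub_word_mem hS)
      rw [Ctx.plug, ← hv]
      have e : (c₁.mulLeft v₁).eval s₁ - (Ctx.mulRight c₂ v₂).eval s₂ =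
          c₂.eval s₂ * (c₁.eval s₁ - word k v₂.1) -
            (c₂.eval s₂ - word k v₁.1) * c₁.eval s₁ := by
        rw [Ctx.eval, Ctx.eval, sub_mul, mul_sub]
        abel
      rw [e]
      exact sub_mem m₂ m₁

theorem IsNormalSWord.sub_mem (hS : ∀ s ∈ S, IsMonic s) (hGS : IsGroebnerShirshov S)
    {p q : RS k X} {z : GoodWord X} (hp : IsNormalSWord S p z) (hq : IsNormalSWord S q z) :
    p - q ∈ normalLT S z.1 := by
  obtain ⟨s₁, hs₁, t₁, ht₁, c₁, hc₁, rfl⟩ := hp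
  obtain ⟨s₂, hs₂, t₂, ht₂, c₂, hc₂, rfl⟩ := hq
  exact eval_sub_eval_mem hS hGS hs₁ hs₂ ht₁ ht₂ z.2 hc₁ hc₂

/-- If the right-multiplication compositions are trivial, the normal `S`-words span `Id(S)`. -/
theorem algIdeal_le_span_normal (hS : ∀ s ∈ S, IsMonic s) (hR : RightMulTrivial S) :
    algIdeal k S ≤ Submodule.span k {p | ∃ v : GoodWord X, IsNormalSWord S p v} := by
  have hle (m : FreeMagma X) :
      normalLE S m ≤ Submodule.span k {p | ∃ v : GoodWord X, IsNormalSWord S p v} :=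
    Submodule.span_mono fun _ ⟨v, hp, _⟩ => ⟨v, hp⟩
  refine algIdeal_le ?_ ?_
  · intro s hs
    obtain ⟨t, ht⟩ := hS s hs
    exact Submodule.subset_span ⟨t, s, hs, t, ⟨1, ht⟩, .hole, rfl, rfl⟩
  · refine fun x hx a => ⟨mul_mem_of_mem_span ?_ (mem_goodSpan_univ a) hx,
      mul_mem_of_mem_span ?_ hx (mem_goodSpan_univ a)⟩
    · rintro _ ⟨w, -, rfl⟩ p ⟨z, hp⟩
      exact hle _ (hp.word_mul_mem hR w)
    · rintro p ⟨z, hp⟩ _ ⟨w, -, rfl⟩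
      exact hle _ (hp.mul_word_mem hR w)

end NormalWords

/-! ### The equivalent conditions -/

section Equivalences

variable {k X : Type*} [Field k] [LinearOrder X] {S : Set (RS k X)}

/-- Every nonzero element of `Id(S)` has the leading word of a normal `S`-word. -/
def LeadingWordsReducible (S : Set (RS k X)) : Prop :=
  ∀ f ∈ algIdeal k S, f ≠ 0 →
    ∃ w : GoodWord X, IsLeadingWord f w ∧ ∃ p : RS k X, IsNormalSWord S p w

/-- `f` is a linear combination of normal `S`-words with strictly decreasing leading words, all of
which satisfy `P`. -/
def HasNormalExpansion (S : Set (RS k X)) (P : GoodWord X → Prop) (f : RS k X) : Prop :=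
  ∃ (n : ℕ) (α : Fin n → k) (p : Fin n → RS k X) (w : Fin n → GoodWord X),
    (∀ i, IsNormalSWord S (p i) (w i)) ∧ (∀ i j, i < j → DegLexLT (w j).1 (w i).1) ∧
    f = ∑ i, α i • p i ∧ ∀ i, P (w i)

theorem HasNormalExpansion.zero (P : GoodWord X → Prop) : HasNormalExpansion S P 0 :=
  ⟨0, Fin.elim0, Fin.elim0, Fin.elim0, fun i => i.elim0, fun i => i.elim0, by simp,
    fun i => i.elim0⟩

theorem HasNormalExpansion.mono {P Q : GoodWord X → Prop} (h : ∀ v, P v → Q v) {f : RS k X}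
    (hf : HasNormalExpansion S P f) : HasNormalExpansion S Q f := by
  obtain ⟨n, α, p, w, h1, h2, h3, h4⟩ := hf
  exact ⟨n, α, p, w, h1, h2, h3, fun i => h _ (h4 i)⟩

theorem HasNormalExpansion.cons {f p : RS k X} {w : GoodWord X} (hp : IsNormalSWord S p w) {c : k}
    (hf : HasNormalExpansion S (fun v => v.1 < w.1) (f - c • p)) :
    HasNormalExpansion S (fun v => v.1 ≤ w.1) f := by
  obtain ⟨n, α, q, v, h1, h2, h3, h4⟩ := hf
  refine ⟨n + 1, Fin.cons c α, Fin.cons p q, Fin.cons w v, ?_, ?_, ?_, ?_⟩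
  · refine Fin.cases ?_ fun i => ?_
    · exact hp
    · exact h1 i
  · refine Fin.cases (Fin.cases ?_ fun j _ => ?_) fun i => Fin.cases ?_ fun j hij => ?_
    · exact fun h => absurd h (lt_irrefl _)
    · exact h4 j
    · exact fun h => absurd h (Fin.not_lt_zero _)
    · exact h2 i j (Fin.succ_lt_succ_iff.1 hij)
  · rw [Fin.sum_univ_succ]
    simp only [Fin.cons_zero, Fin.cons_succ]
    rw [← h3]
    abel
  · refine Fin.cases ?_ fun i => ?_
    · exact le_rfl
    · exact (h4 i).le

theorem HasNormalExpansion.mem_span {P : GoodWord X → Prop} {f : RS k X}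
    (hf : HasNormalExpansion S P f) :
    f ∈ Submodule.span k {p : RS k X | ∃ v : GoodWord X, IsNormalSWord S p v ∧ P v} := by
  obtain ⟨n, α, q, v, h1, -, rfl, h4⟩ := hf
  exact Submodule.sum_mem _ fun i _ => Submodule.smul_mem _ _
    (Submodule.subset_span ⟨v i, h1 i, h4 i⟩)

/-- The leading words that occur in a nonzero combination of normal `S`-words are bounded by one of
them. -/
theorem eq_zero_or_exists_mem_normalLE {P : GoodWord X → Prop} {f : RS k X}
    (hf : f ∈ Submodule.span k {p : RS k X | ∃ v : GoodWord X, IsNormalSWord S p v ∧ P v}) :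
    f = 0 ∨ ∃ z : GoodWord X, P z ∧ f ∈ normalLE S z.1 := by
  induction hf using Submodule.span_induction with
  | mem p hp =>
    obtain ⟨v, hp, hv⟩ := hp
    exact .inr ⟨v, hv, hp.mem_normalLE⟩
  | zero => exact .inl rfl
  | add f g _ _ hf hg =>
    obtain rfl | ⟨y, hy, hf⟩ := hf
    · rwa [zero_add]
    obtain rfl | ⟨z, hz, hg⟩ := hg
    · rw [add_zero]
      exact .inr ⟨y, hy, hf⟩
    rcases le_total y.1 z.1 with h | h
    · exact .inr ⟨z, hz, add_mem (normalLE_mono h hf) hg⟩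
    · exact .inr ⟨y, hy, add_mem hf (normalLE_mono h hg)⟩
  | smul c f _ hf =>
    obtain rfl | ⟨y, hy, hf⟩ := hf
    · exact .inl (smul_zero c)
    · exact .inr ⟨y, hy, Submodule.smul_mem _ c hf⟩

theorem goodSpan_irr_eq :
    goodSpan k (Irr S) = Submodule.span k (Set.range fun u : Irr S => word k u.1.1) := by
  rw [goodSpan, Set.image_eq_range]

theorem goodSpan_sup_mono {s t : Set (GoodWord X)} (h : s ⊆ t) (I : Submodule k (RS k X)) :
    goodSpan k s ⊔ I ≤ goodSpan k t ⊔ I := sup_le_sup_right (goodSpan_mono h) I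

variable [WellFoundedLT X]

theorem normalLT_le_goodLT (hS : ∀ s ∈ S, IsMonic s) (m : FreeMagma X) :
    normalLT S m ≤ goodLT k m := by
  refine Submodule.span_le.2 ?_
  rintro p ⟨v, hp, hv⟩
  exact goodLE_le_goodLT hv (hp.mem_goodLE hS)

/-- Modulo smaller normal `S`-words, a combination of normal `S`-words with leading words at most
`z` is a multiple of any single normal `S`-word with leading word `z`. -/
theorem exists_sub_smul_mem_normalLT (hS : ∀ s ∈ S, IsMonic s) (hGS : IsGroebnerShirshov S)
    {f p : RS k X} {z : GoodWord X} (hp : IsNormalSWord S p z) (hf : f ∈ normalLE S z.1) :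
    ∃ c : k, f - c • p ∈ normalLT S z.1 := by
  induction hf using Submodule.span_induction with
  | mem q hq =>
    obtain ⟨v, hq, hv⟩ := hq
    obtain hlt | heq := hv.lt_or_eq
    · exact ⟨0, by
        rw [zero_smul, sub_zero]
        exact normalLE_le_normalLT hlt hq.mem_normalLE⟩
    · obtain rfl := Subtype.ext heq
      exact ⟨1, by
        rw [one_smul]
        exact hq.sub_mem hS hGS hp⟩
  | zero => exact ⟨0, by simp⟩
  | add f g _ _ hf hg =>
    obtain ⟨c, hf⟩ := hf
    obtain ⟨d, hg⟩ := hg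
    refine ⟨c + d, ?_⟩
    rw [add_smul, add_sub_add_comm]
    exact add_mem hf hg
  | smul a f _ hf =>
    obtain ⟨c, hf⟩ := hf
    refine ⟨a * c, ?_⟩
    rw [mul_smul, ← smul_sub]
    exact Submodule.smul_mem _ a hf

/-- A combination of normal `S`-words with the least possible bound `z` on their leading words has
the leading word `z`: the terms with leading word `z` cannot cancel, since they could then be
replaced by smaller ones. -/
theorem IsGroebnerShirshov.leadingWordsReducible (hS : ∀ s ∈ S, IsMonic s)
    (hGS : IsGroebnerShirshov S) : LeadingWordsReducible S := by
  intro f hf hf0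
  have hex : ∃ z : GoodWord X, f ∈ normalLE S z.1 := by
    have h := algIdeal_le_span_normal hS hGS.2 hf
    have h' := eq_zero_or_exists_mem_normalLE (S := S) (P := fun _ => True) (f := f)
      (by simpa only [and_true] using h)
    obtain h0 | ⟨z, -, hz⟩ := h'
    · exact absurd h0 hf0
    · exact ⟨z, hz⟩
  obtain ⟨z, hz, hmin⟩ : ∃ z : GoodWord X, f ∈ normalLE S z.1 ∧
      ∀ y : GoodWord X, y.1 < z.1 → f ∉ normalLE S y.1 := by
    obtain ⟨z, hz, hmin⟩ := (wellFounded_lt (α := FreeMagma X)).onFun.has_min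
      {z : GoodWord X | f ∈ normalLE S z.1} hex
    exact ⟨z, hz, fun y hy hfy => hmin y hfy hy⟩
  have hnot : f ∉ normalLT S z.1 := by
    intro h
    obtain h0 | ⟨y, hy, h⟩ := eq_zero_or_exists_mem_normalLE (P := fun v => v.1 < z.1) h
    · exact hf0 h0
    · exact hmin y hy h
  by_cases hp : ∃ p, IsNormalSWord S p z
  · obtain ⟨p, hp⟩ := hp
    refine ⟨z, ?_, p, hp⟩
    obtain ⟨c, hc⟩ := exists_sub_smul_mem_normalLT hS hGS hp hz
    refine isLeadingWord_of_sub_mem (c := c) ?_ ?_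
    · rintro rfl
      exact hnot (by simpa using hc)
    · have := add_mem (normalLT_le_goodLT hS _ hc)
        ((goodLT k z.1).smul_mem c (hp.sub_word_mem hS))
      rwa [smul_sub, sub_add_sub_cancel] at this
  · refine absurd (Submodule.span_mono ?_ hz) hnot
    rintro p ⟨v, hpv, hv⟩
    refine ⟨v, hpv, lt_of_le_of_ne hv fun h => hp ⟨p, ?_⟩⟩
    obtain rfl := Subtype.ext h
    exact hpv

theorem LeadingWordsReducible.hasNormalExpansion (hS : ∀ s ∈ S, IsMonic s)
    (hL : LeadingWordsReducible S) {f : RS k X} (hf : f ∈ algIdeal k S) {w : GoodWord X}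
    (hw : IsLeadingWord f w) : HasNormalExpansion S (fun v => v.1 ≤ w.1) f := by
  induction hm : w.1 using WellFoundedLT.induction generalizing f w with
  | ind m ih =>
  subst hm
  obtain ⟨w', hw', p, hp⟩ := hL f hf hw.ne_zero
  obtain rfl := hw.unique hw'
  have hlow := sub_smul_mem_goodLT (isLeadingWord_iff.1 hw).2 (hp.sub_word_mem hS)
  have hid : f - (goodBasis k X).repr f w • p ∈ algIdeal k S :=
    sub_mem hf (Submodule.smul_mem _ _ hp.mem_algIdeal)
  refine .cons hp (c := (goodBasis k X).repr f w) ?_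
  by_cases h0 : f - (goodBasis k X).repr f w • p = 0
  · rw [h0]
    exact .zero _
  · obtain ⟨v, hv⟩ := exists_isLeadingWord h0
    have hvw := hv.lt_of_mem_goodLT hlow
    exact (ih v.1 hvw hid hv rfl).mono fun u hu => lt_of_le_of_lt hu hvw

theorem LeadingWordsReducible.isGroebnerShirshov (hS : ∀ s ∈ S, IsMonic s)
    (hL : LeadingWordsReducible S) : IsGroebnerShirshov S := by
  constructor
  · intro f hf g hg u t hu ht c huc
    have hid : f - c.eval g ∈ algIdeal k S :=
      sub_mem (subset_algIdeal S hf) (eval_mem_algIdeal hg c)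
    have hlow : f - c.eval g ∈ goodLT k u.1 := by
      have h1 := (hS f hf).sub_word_mem hu
      have h2 := plug_lead ((hS g hg).sub_word_mem ht) c
      rw [← huc] at h2
      rw [← sub_sub_sub_cancel_right _ _ (word k u.1)]
      exact sub_mem h1 h2
    by_cases h0 : f - c.eval g = 0
    · rw [h0]
      exact zero_mem _
    · obtain ⟨v, hv⟩ := exists_isLeadingWord h0
      exact ((hL.hasNormalExpansion hS hid hv).mono fun y hy =>
        lt_of_le_of_lt hy (hv.lt_of_mem_goodLT hlow)).mem_span
  · intro f hf u w hu _
    obtain ⟨l, hl⟩ := exists_isLeadingWord (mul_word_ne_zero hu.ne_zero w)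
    exact ⟨l, hl, (hL.hasNormalExpansion hS
      (algIdeal_mul_right k S (subset_algIdeal S hf) _) hl).mem_span⟩

/-- The first nonzero term of an expansion with decreasing leading words gives the leading word. -/
theorem exists_isLeadingWord_of_expansion (hS : ∀ s ∈ S, IsMonic s) {n : ℕ} {α : Fin n → k}
    {p : Fin n → RS k X} {w : Fin n → GoodWord X} (hp : ∀ i, IsNormalSWord S (p i) (w i))
    (hw : ∀ i j, i < j → (w j).1 < (w i).1) (h0 : ∑ i, α i • p i ≠ 0) :
    ∃ i, IsLeadingWord (∑ i, α i • p i) (w i) := by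
  obtain ⟨i₀, -, hi₀⟩ := Finset.exists_ne_zero_of_sum_ne_zero h0
  obtain ⟨i, hi, hmin⟩ := (wellFounded_lt (α := Fin n)).has_min {i | α i ≠ 0}
    ⟨i₀, fun h => hi₀ (by rw [h, zero_smul])⟩
  refine ⟨i, isLeadingWord_of_sub_mem hi ?_⟩
  rw [← Finset.add_sum_erase _ _ (Finset.mem_univ i), add_sub_right_comm, ← smul_sub]
  refine add_mem (Submodule.smul_mem _ _ ((hp i).sub_word_mem hS))
    (Submodule.sum_mem _ fun j hj => ?_)
  by_cases hj0 : α j = 0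
  · rw [hj0, zero_smul]
    exact zero_mem _
  · have hij : i < j := lt_of_le_of_ne (not_lt.1 (hmin j hj0)) (Finset.ne_of_mem_erase hj).symm
    exact Submodule.smul_mem _ _ (goodLE_le_goodLT (hw i j hij) ((hp j).mem_goodLE hS))

/-- Modulo `Id(S)`, a good word is a combination of words of `Irr(S)` that do not exceed it. -/
theorem word_mem_irr_sup (hS : ∀ s ∈ S, IsMonic s) (w : GoodWord X) :
    word k w.1 ∈ goodSpan k {v | v ∈ Irr S ∧ v.1 ≤ w.1} ⊔ algIdeal k S := by
  induction hm : w.1 using WellFoundedLT.induction generalizing w with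
  | ind m ih =>
  subst hm
  by_cases hw : w ∈ Irr S
  · exact Submodule.mem_sup_left (word_mem_goodSpan ⟨hw, le_rfl⟩)
  · obtain ⟨p, hp⟩ := not_not.1 hw
    rw [← sub_sub_cancel p (word k w.1)]
    refine sub_mem (Submodule.mem_sup_right hp.mem_algIdeal) ?_
    refine (Submodule.span_le.2 ?_) (hp.sub_word_mem hS)
    rintro _ ⟨v, hv, rfl⟩
    have hv : v.1 < w.1 := hv
    refine goodSpan_sup_mono ?_ _ (ih v.1 hv v rfl)
    exact fun u hu => ⟨hu.1, hu.2.trans hv.le⟩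

theorem span_mk_irr_eq_top (hS : ∀ s ∈ S, IsMonic s) :
    Submodule.span k (Set.range fun u : Irr S => AlgQuot.mk k S (word k u.1.1)) = ⊤ := by
  rw [eq_top_iff]
  rintro f -
  obtain ⟨f, rfl⟩ := AlgQuot.mk_surjective k S f
  have h1 : f ∈ goodSpan k (Irr S) ⊔ algIdeal k S := by
    refine (Submodule.span_le.2 ?_) (mem_goodSpan_univ f)
    rintro _ ⟨v, -, rfl⟩
    exact goodSpan_sup_mono (fun u hu => hu.1) _ (word_mem_irr_sup hS v)
  obtain ⟨g, hg, h, hh, rfl⟩ := Submodule.mem_sup.1 h1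
  have hgh : AlgQuot.mk k S (g + h) = AlgQuot.mk k S g := by
    rw [AlgQuot.mk_eq_mk, add_sub_cancel_left]
    exact hh
  rw [hgh]
  rw [goodSpan_irr_eq] at hg
  have := Submodule.mem_map_of_mem (f := AlgQuot.mk k S) hg
  rwa [Submodule.map_span, ← Set.range_comp] at this

/-- The images of the words of `Irr(S)` in the quotient are linearly independent if and only if the
span of these words meets `Id(S)` trivially. -/
theorem linearIndependent_mk_irr_iff :
    LinearIndependent k (fun u : Irr S => AlgQuot.mk k S (word k u.1.1)) ↔
      ∀ f ∈ goodSpan k (Irr S), f ∈ algIdeal k S → f = 0 := by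
  have hli : LinearIndependent k fun u : Irr S => word k u.1.1 :=
    linearIndependent_word.comp _ Subtype.val_injective
  have hmk (f : RS k X) : AlgQuot.mk k S f = 0 ↔ f ∈ algIdeal k S := by
    rw [← map_zero (AlgQuot.mk k S), AlgQuot.mk_eq_mk, sub_zero]
  constructor
  · intro h f hf hid
    rw [goodSpan_irr_eq] at hf
    obtain ⟨c, rfl⟩ := (Finsupp.mem_span_range_iff_exists_finsupp).1 hf
    rw [← hmk, Finsupp.sum, map_sum] at hid
    simp only [map_smul] at hid
    have : c = 0 := linearIndependent_iff.1 h c hid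
    rw [this, Finsupp.sum_zero_index]
  · intro h
    refine hli.map (f := AlgQuot.mk k S) ?_
    rw [← goodSpan_irr_eq, Submodule.disjoint_def]
    exact fun f hf hker => h f hf ((hmk f).1 hker)

theorem leadingWordsReducible_iff (hS : ∀ s ∈ S, IsMonic s) :
    LeadingWordsReducible S ↔
      LinearIndependent k fun u : Irr S => AlgQuot.mk k S (word k u.1.1) := by
  rw [linearIndependent_mk_irr_iff]
  constructor
  · intro hL f hf hid
    by_contra h0
    obtain ⟨w, hw, hp⟩ := hL f hid h0
    exact mem_goodSpan_iff.1 hf w (isLeadingWord_iff.1 hw).1 hp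
  · intro h f hid h0
    obtain ⟨w, hw⟩ := exists_isLeadingWord h0
    refine ⟨w, hw, ?_⟩
    by_contra hirr
    obtain ⟨hc, hle⟩ := isLeadingWord_iff.1 hw
    -- reducing the smaller words of `f` keeps its leading word, which lies in `Irr(S)`
    have hlow : f - (goodBasis k X).repr f w • word k w.1 ∈
        goodSpan k {v | v ∈ Irr S ∧ v.1 < w.1} ⊔ algIdeal k S := by
      refine (Submodule.span_le.2 ?_) (sub_smul_mem_goodLT hle (p := word k w.1) (by simp))
      rintro _ ⟨v, hv, rfl⟩
      refine goodSpan_sup_mono ?_ _ (word_mem_irr_sup hS v)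
      exact fun u hu => ⟨hu.1, lt_of_le_of_lt hu.2 hv⟩
    obtain ⟨g, hg, e, he, hge⟩ := Submodule.mem_sup.1 hlow
    have heq : f - e = (goodBasis k X).repr f w • word k w.1 + g := by
      rw [eq_sub_of_add_eq hge]
      abel
    have hirr' : f - e ∈ goodSpan k (Irr S) := by
      rw [heq]
      exact add_mem (Submodule.smul_mem _ _ (word_mem_goodSpan hirr))
        (goodSpan_mono (fun u hu => hu.1) hg)
    have hlead : IsLeadingWord (f - e) w := by
      refine isLeadingWord_of_sub_mem hc ?_
      rw [heq, add_sub_cancel_left]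
      exact goodSpan_mono (fun u hu => hu.2) hg
    exact hlead.ne_zero (h _ hirr' (sub_mem hid he))

end Equivalences

end RSAlg

theorem theoremt1 {k : Type*} [Field k] {X : Type*} [LinearOrder X] [WellFoundedLT X]
    (S : Set (RSAlg.RS k X)) (hmonic : ∀ s ∈ S, RSAlg.IsMonic s) :
    List.TFAE
      [ -- (i) `S` is a Gröbner–Shirshov basis
        RSAlg.IsGroebnerShirshov S,
        -- (ii) leading words of nonzero elements of `Id(S)`
        ∀ f ∈ RSAlg.algIdeal k S, f ≠ 0 →
          ∃ w : RSAlg.GoodWord X, RSAlg.IsLeadingWord f w ∧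
            ∃ p : RSAlg.RS k X, RSAlg.IsNormalSWord S p w,
        -- (ii)' expansions in normal `S`-words
        ∀ f ∈ RSAlg.algIdeal k S,
          ∃ (n : ℕ) (α : Fin n → k) (p : Fin n → RSAlg.RS k X)
            (w : Fin n → RSAlg.GoodWord X),
            (∀ i, RSAlg.IsNormalSWord S (p i) (w i)) ∧
            (∀ i j, i < j → RSAlg.DegLexLT (w j).1 (w i).1) ∧
            f = ∑ i, α i • p i,
        -- (iii) `Irr(S)` is a linear basis of the quotient algebra
        LinearIndependent k (fun u : RSAlg.Irr S =>
            RSAlg.AlgQuot.mk k S (RSAlg.word k u.1.1)) ∧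
          Submodule.span k (Set.range (fun u : RSAlg.Irr S =>
            RSAlg.AlgQuot.mk k S (RSAlg.word k u.1.1))) = ⊤ ] := by
  tfae_have 1 → 2 := fun h => h.leadingWordsReducible hmonic
  tfae_have 2 → 1 := fun h => RSAlg.LeadingWordsReducible.isGroebnerShirshov hmonic h
  tfae_have 2 → 3 := by
    intro h f hf
    by_cases h0 : f = 0
    · obtain ⟨n, α, p, w, h1, h2, h3, -⟩ :=
        RSAlg.HasNormalExpansion.zero (S := S) fun _ => True
      exact ⟨n, α, p, w, h1, h2, h0.trans h3⟩
    · obtain ⟨w, hw⟩ := RSAlg.exists_isLeadingWord h0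
      obtain ⟨n, α, p, w, h1, h2, h3, -⟩ :=
        RSAlg.LeadingWordsReducible.hasNormalExpansion hmonic h hf hw
      exact ⟨n, α, p, w, h1, h2, h3⟩
  tfae_have 3 → 2 := by
    intro h f hf h0
    obtain ⟨n, α, p, w, h1, h2, rfl⟩ := h f hf
    obtain ⟨i, hi⟩ := RSAlg.exists_isLeadingWord_of_expansion hmonic h1 h2 h0
    exact ⟨w i, hi, p i, h1 i⟩
  tfae_have 2 ↔ 4 := by
    rw [and_iff_left (RSAlg.span_mk_irr_eq_top hmonic)]
    exact RSAlg.leadingWordsReducible_iff hmonic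
  tfae_finish
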